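/- Let $L\ge 2$ and consider the $L\times L$ square lattice with periodic boundary conditions, with one party (qubit) on each of its $N=2L^2$ edges. For a vertex $v$ (a plaquette $p$) write $i\in v$ ($i\in p$) for the four edges $i$ meeting at $v$ (bounding $p$). Let $\mathrm X,\mathrm Z$ be the Pauli matrices, $S_v=\prod_{i\in v}\mathrm X^{(i)}$, $S_p=\prod_{i\in p}\mathrm Z^{(i)}$, and let the toric code space $C_N^{\mathrm{tor}}\subset(\mathbb C^2)^{\otimes N}$ be the common $+1$ eigenspace of all $S_v$ and $S_p$. A quantum realization consists of finite-dimensional Hilbert spaces $\mathcal H_{P_i}$, one for each party $i$, an arbitrary complex inner product space $\mathcal H_E$, a unit vector $|\phi\rangle\in\mathcal H_{P_1}\otimes\dots\otimes\mathcal H_{P_N}\otimes\mathcal H_E$, and, for every party $i$, two Hermitian operators $\mathrm A_0^{(i)},\mathrm A_1^{(i)}$ on $\mathcal H_{P_i}$ with square $\mathbb 1$. Fix a party $j$ and put $$\tilde X^{(j)}=\tfrac{1}{\sqrt2}(\mathrm A_0^{(j)}+\mathrm A_1^{(j)}),\quad \tilde Z^{(j)}=\tfrac{1}{\sqrt2}(\mathrm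 A_0^{(j)}-\mathrm A_1^{(j)}),\qquad \tilde X^{(i)}=\mathrm A_0^{(i)},\quad \tilde Z^{(i)}=\mathrm A_1^{(i)}\quad(i\ne j).$$ The toric-code Bell expression is $$I_N^{\mathrm{tor}}=\langle\phi|\Big(\sum_v\prod_{i\in v}\tilde X^{(i)}+\sum_p\prod_{i\in p}\tilde Z^{(i)}\Big)\otimes\mathbb 1_E|\phi\rangle .$$ Then $\dim C_N^{\mathrm{tor}}=4$, and the maximum of $I_N^{\mathrm{tor}}$ over all quantum realizations exists and equals $\beta_q^{\mathrm{tor}}(N)=N$. Moreover, let a realization satisfy $I_N^{\mathrm{tor}}=N$, and let $\rho_i$ be the reduced density matrix of $|\phi\rangle$ for party $i$. Then: 1. For every $i$, $\big(\tilde X^{(i)}\big)^2=\big(\tilde Z^{(i)}\big)^2=\mathbb 1$ and $\tilde X^{(i)}\tilde Z^{(i)}+\tilde Z^{(i)}\tilde X^{(i)}=0$ on the support of $\rho_i$. 2. For every $i$ there are $d_i\in\mathbb N$ and an operator $U_i:\mathcal H_{P_i}\to\mathbb C^2\otimes\mathbb C^{d_i}$ that maps the support of $\rho_i$ unitarily onto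 $\mathbb C^2\otimes\mathbb C^{d_i}$ and vanishes on its orthogonal complement (so $U_i$ is unitary if $\rho_i$ has full rank), such that $$U_i\tilde X^{(i)}=(\mathrm X\otimes\mathbb 1_{d_i})U_i,\qquad U_i\tilde Z^{(i)}=(\mathrm Z\otimes\mathbb 1_{d_i})U_i\qquad\text{for every }i,$$ and such that for every orthonormal basis $|\psi_1\rangle,\dots,|\psi_4\rangle$ of $C_N^{\mathrm{tor}}$ there are real numbers $c_1,\dots,c_4\ge0$ with $\sum_k c_k^2=1$ and unit vectors $|\xi_1\rangle,\dots,|\xi_4\rangle\in\bigotimes_i\mathbb C^{d_i}\otimes\mathcal H_E$ with $$\Big(\bigotimes_iU_i\otimes\mathbb 1_E\Big)|\phi\rangle=\sum_{k=1}^4c_k\,|\psi_k\rangle\otimes|\xi_k\rangle .$$ -/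

import Mathlib

open scoped Matrix Kronecker

universe u

noncomputable section

namespace ToricCode

/-! ### The lattice: an `L × L` square lattice with periodic boundary conditions -/

/-- Vertices `(x, y)` of the torus. Plaquettes are labelled by their lower left corner. -/
abbrev Site (L : ℕ) : Type := ZMod L × ZMod L

/-- Qubits (parties) sit on the edges: `((x, y), false)` is the horizontal edge from `(x, y)` to
`(x + 1, y)`, and `((x, y), true)` is the vertical edge from `(x, y)` to `(x, y + 1)`. -/
abbrev Qubit (L : ℕ) : Type := Site L × Bool

/-- The edges that meet at a vertex. -/
def starOf {L : ℕ} (v : Site L) : Finset (Qubit L) :=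
  {((v.1, v.2), false), ((v.1 - 1, v.2), false), ((v.1, v.2), true), ((v.1, v.2 - 1), true)}

/-- The edges that bound a plaquette. -/
def boundaryOf {L : ℕ} (p : Site L) : Finset (Qubit L) :=
  {((p.1, p.2), false), ((p.1, p.2 + 1), false), ((p.1, p.2), true), ((p.1 + 1, p.2), true)}

/-! ### Tensor products in coordinates

The tensor product of the spaces `ℂ ^ (m i)` has the basis `∀ i, m i`, and its tensor product
with an inner product space `E` is the `ℓ²` sum of copies of `E` indexed by that basis. -/

/-- The tensor product `⨂ i, M i` of matrices. -/
def tensorMat {ι : Type*} [Fintype ι] {m n : ι → Type*} (M : ∀ i, Matrix (m i) (n i) ℂ) :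
    Matrix (∀ i, m i) (∀ i, n i) ℂ :=
  Matrix.of fun x y => ∏ i, M i (x i) (y i)

/-- The product over the sites of `s` of the one-site operators `M i` (identity elsewhere). -/
def onSites {ι : Type*} [Fintype ι] [DecidableEq ι] {m : ι → Type*} [∀ i, DecidableEq (m i)]
    (s : Finset ι) (M : ∀ i, Matrix (m i) (m i) ℂ) : Matrix (∀ i, m i) (∀ i, m i) ℂ :=
  tensorMat fun i => if i ∈ s then M i else 1

/-- The operator `M ⊗ 𝟙_E` applied to a vector of `ℂ ^ n ⊗ E`. -/
def act {m n : Type*} [Fintype n] {E : Type*} [NormedAddCommGroup E] [InnerProductSpace ℂ E]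
    (M : Matrix m n ℂ) (φ : PiLp 2 (fun _ : n => E)) : PiLp 2 (fun _ : m => E) :=
  WithLp.toLp 2 fun x => ∑ y, M x y • φ y

/-- The vector `ψ ⊗ ξ`, for `ψ` in the `N`-qubit space and `ξ` in `(⨂ i, ℂ ^ (d i)) ⊗ E`, as a
vector of `(⨂ i, ℂ² ⊗ ℂ ^ (d i)) ⊗ E`. -/
def joint {ι : Type*} {d : ι → ℕ} {E : Type*} [NormedAddCommGroup E] [InnerProductSpace ℂ E]
    (ψ : EuclideanSpace ℂ (ι → Fin 2)) (ξ : PiLp 2 (fun _ : (∀ i, Fin (d i)) => E)) :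
    PiLp 2 (fun _ : (∀ i, Fin 2 × Fin (d i)) => E) :=
  WithLp.toLp 2 fun x => ψ (fun i => (x i).1) • ξ (fun i => (x i).2)

/-! ### The toric code -/

def pauliX : Matrix (Fin 2) (Fin 2) ℂ := !![0, 1; 1, 0]

def pauliZ : Matrix (Fin 2) (Fin 2) ℂ := !![1, 0; 0, -1]

/-- The vertex stabilizing operator `S_v = ∏_{i ∈ v} X⁽ⁱ⁾`. -/
def vertexOp {L : ℕ} [NeZero L] (v : Site L) : Matrix (Qubit L → Fin 2) (Qubit L → Fin 2) ℂ :=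
  onSites (starOf v) fun _ => pauliX

/-- The plaquette stabilizing operator `S_p = ∏_{i ∈ p} Z⁽ⁱ⁾`. -/
def plaquetteOp {L : ℕ} [NeZero L] (p : Site L) : Matrix (Qubit L → Fin 2) (Qubit L → Fin 2) ℂ :=
  onSites (boundaryOf p) fun _ => pauliZ

/-- The code space: the common `+1` eigenspace of all `S_v` and `S_p`. -/
def codeSpace (L : ℕ) [NeZero L] : Submodule ℂ (EuclideanSpace ℂ (Qubit L → Fin 2)) :=
  (⨅ v : Site L, Module.End.eigenspace (Matrix.toEuclideanLin (vertexOp v)) 1) ⊓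
    (⨅ p : Site L, Module.End.eigenspace (Matrix.toEuclideanLin (plaquetteOp p)) 1)

/-! ### The Bell scenario -/

/-- A quantum realization with local dimensions `D i` and purifying space `E`: a pure state shared
by the parties and `E`, and two observables with outcomes `±1` for each party. -/
structure Realization (L : ℕ) [NeZero L] (D : Qubit L → ℕ)
    (E : Type*) [NormedAddCommGroup E] [InnerProductSpace ℂ E] where
  state : PiLp 2 (fun _ : (∀ i, Fin (D i)) => E)
  norm_state : ‖state‖ = 1
  obs : ∀ i, Fin 2 → Matrix (Fin (D i)) (Fin (D i)) ℂ
  isHermitian_obs : ∀ i x, (obs i x).IsHermitian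
  obs_mul_obs : ∀ i x, obs i x * obs i x = 1

namespace Realization

variable {L : ℕ} [NeZero L] {D : Qubit L → ℕ} {E : Type*} [NormedAddCommGroup E]
  [InnerProductSpace ℂ E]

/-- `X̃⁽ⁱ⁾`: equal to `(A₀ + A₁) / √2` for the chosen party `j`, and to `A₀` for the others. -/
def tildeX (R : Realization L D E) (j i : Qubit L) : Matrix (Fin (D i)) (Fin (D i)) ℂ :=
  if i = j then ((√2 : ℝ) : ℂ)⁻¹ • (R.obs i 0 + R.obs i 1) else R.obs i 0

/-- `Z̃⁽ⁱ⁾`: equal to `(A₀ - A₁) / √2` for the chosen party `j`, and to `A₁` for the others. -/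
def tildeZ (R : Realization L D E) (j i : Qubit L) : Matrix (Fin (D i)) (Fin (D i)) ℂ :=
  if i = j then ((√2 : ℝ) : ℂ)⁻¹ • (R.obs i 0 - R.obs i 1) else R.obs i 1

/-- The Bell operator `∑_v ∏_{i ∈ v} X̃⁽ⁱ⁾ + ∑_p ∏_{i ∈ p} Z̃⁽ⁱ⁾`. -/
def bellOp (R : Realization L D E) (j : Qubit L) :
    Matrix (∀ i, Fin (D i)) (∀ i, Fin (D i)) ℂ :=
  ∑ v : Site L, onSites (starOf v) (R.tildeX j) +
    ∑ p : Site L, onSites (boundaryOf p) (R.tildeZ j)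

/-- The value of the Bell expression (the Bell operator is Hermitian, so that its expectation
value is real). -/
def bellValue (R : Realization L D E) (j : Qubit L) : ℝ :=
  (inner ℂ R.state (act (R.bellOp j) R.state)).re

/-- The reduced density matrix of party `i` (the other parties and `E` are traced out). -/
def reducedState (R : Realization L D E) (i : Qubit L) : Matrix (Fin (D i)) (Fin (D i)) ℂ :=
  Matrix.of fun a b =>
    ∑ x : (∀ k, Fin (D k)) with x i = a, inner ℂ (R.state (Function.update x i b)) (R.state x)

end Realization

/-- All values that the Bell expression takes in quantum theory, for a finite-dimensional space
at each party. -/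
def quantumValues (L : ℕ) [NeZero L] (j : Qubit L) : Set ℝ :=
  {β | ∃ (D : Qubit L → ℕ) (E : Type u) (_ : NormedAddCommGroup E) (_ : InnerProductSpace ℂ E)
    (R : Realization L D E), R.bellValue j = β}

end ToricCode

end

open ToricCode

/-!
The Bell value of a realization is the number `N` of qubits minus a sum of squares
(`Realization.bellValue_eq`). A term `∏ M i` of the Bell operator factors as `P * Q`, with `P` the
factor at the special party `j` (or `1`) and `Q` an involution on the other parties; then
`⟨P * Q⟩ = (⟨P²⟩ + 1) / 2 - ‖P φ - Q φ‖² / 2`. Two stars and two boundaries contain `j`, and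
`X̃⁽ʲ⁾² + Z̃⁽ʲ⁾² = 2`, so that the first summands add up to `N`. A code state with Pauli observables
attains `N`.

At the maximum all squares vanish. Hence every term of the Bell operator fixes the state, and
`X̃⁽ⁱ⁾` and `Z̃⁽ⁱ⁾` square to `1` on it. They anticommute at `j` by construction. A star and a
boundary that meet share two edges, and since both products fix the state, anticommutation on the
state passes from one of these edges to the other (`anticommute_transfer`); the torus is connected,
so it reaches every edge.

An operator of party `i` kills the state exactly if it kills the reduced state, and
`X̃⁽ⁱ⁾`, which acts on the state like a Hermitian operator of the other parties, commutes with the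
reduced state (`commute_reduced`). So the support of the reduced state is invariant and carries a
pair of anticommuting Hermitian involutions, that is, a qubit (`exists_pauli_frame`). The resulting
isometries turn the terms of the Bell operator into the stabilizers of the toric code, and a vector
fixed by these expands along the code space (`exists_code_decomposition`).

The dimension of the code space is the trace of its projection, the average of all products of
stabilizers. Each product is, up to order, a tensor product of Pauli matrices, and has trace zero
unless it is trivial, which happens for four of the `2 ^ N` products (`finrank_codeSpace`).
-/

noncomputable section

namespace ToricCode

/-! ### Tensor products of matrices -/

section TensorMat

variable {ι : Type*} [Fintype ι]

theorem tensorMat_mul {m n p : ι → Type*} [DecidableEq ι] [∀ i, Fintype (n i)]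
    (M : ∀ i, Matrix (m i) (n i) ℂ) (N : ∀ i, Matrix (n i) (p i) ℂ) :
    tensorMat M * tensorMat N = tensorMat fun i => M i * N i := by
  ext x z
  simp only [tensorMat, Matrix.mul_apply, Matrix.of_apply, ← Finset.prod_mul_distrib]
  rw [Finset.prod_univ_sum, Fintype.piFinset_univ]

theorem tensorMat_one {m : ι → Type*} [∀ i, DecidableEq (m i)] :
    tensorMat (fun i => (1 : Matrix (m i) (m i) ℂ)) = 1 := by
  ext x y
  simp only [tensorMat, Matrix.of_apply, Matrix.one_apply]
  rw [Finset.prod_ite_zero]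
  simp [funext_iff]

theorem conjTranspose_tensorMat {m n : ι → Type*} (M : ∀ i, Matrix (m i) (n i) ℂ) :
    (tensorMat M)ᴴ = tensorMat fun i => (M i)ᴴ := by
  ext x y
  simp [tensorMat, Matrix.conjTranspose_apply]

theorem tensorMat_smul {m n : ι → Type*} (c : ι → ℂ) (M : ∀ i, Matrix (m i) (n i) ℂ) :
    tensorMat (fun i => c i • M i) = (∏ i, c i) • tensorMat M := by
  ext x y
  simp [tensorMat, Finset.prod_mul_distrib]

theorem trace_tensorMat {m : ι → Type*} [DecidableEq ι] [∀ i, Fintype (m i)]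
    (M : ∀ i, Matrix (m i) (m i) ℂ) : (tensorMat M).trace = ∏ i, (M i).trace := by
  simp only [Matrix.trace, tensorMat, Matrix.diag_apply, Matrix.of_apply]
  rw [Finset.prod_univ_sum, Fintype.piFinset_univ]

variable [DecidableEq ι] {m : ι → Type*} [∀ i, DecidableEq (m i)]

theorem onSites_empty (M : ∀ i, Matrix (m i) (m i) ℂ) : onSites ∅ M = 1 := by
  simp [onSites, tensorMat_one]

theorem conjTranspose_onSites (s : Finset ι) (M : ∀ i, Matrix (m i) (m i) ℂ) :
    (onSites s M)ᴴ = onSites s fun i => (M i)ᴴ := by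
  rw [onSites, conjTranspose_tensorMat, onSites]
  congr 1; ext1 i
  split_ifs <;> simp

/-- The operator `M` of site `i`, acting as the identity on the other sites. -/
def atSite (i : ι) (M : Matrix (m i) (m i) ℂ) : Matrix (∀ i, m i) (∀ i, m i) ℂ :=
  tensorMat (Function.update (fun _ => 1) i M)

theorem onSites_singleton (i : ι) (M : ∀ i, Matrix (m i) (m i) ℂ) :
    onSites {i} M = atSite i (M i) := by
  rw [onSites, atSite]
  congr 1; ext1 k
  by_cases h : k = i
  · subst h; simp
  · simp [h]

theorem atSite_apply (i : ι) (M : Matrix (m i) (m i) ℂ) (x y : ∀ i, m i) :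
    atSite i M x y = M (x i) (y i) * ∏ k ∈ {i}ᶜ, (1 : Matrix (m k) (m k) ℂ) (x k) (y k) := by
  simp only [atSite, tensorMat, Matrix.of_apply]
  rw [Fintype.prod_eq_mul_prod_compl i]
  congr 1
  · simp
  · refine Finset.prod_congr rfl fun k hk => ?_
    rw [Function.update_of_ne (by simpa using hk)]

theorem atSite_add (i : ι) (M N : Matrix (m i) (m i) ℂ) :
    atSite i (M + N) = atSite i M + atSite i N := by
  ext x y; simp [atSite_apply, add_mul]

theorem atSite_sub (i : ι) (M N : Matrix (m i) (m i) ℂ) :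
    atSite i (M - N) = atSite i M - atSite i N := by
  ext x y; simp [atSite_apply, sub_mul]

theorem atSite_smul (i : ι) (c : ℂ) (M : Matrix (m i) (m i) ℂ) :
    atSite i (c • M) = c • atSite i M := by
  ext x y; simp [atSite_apply, mul_assoc]

theorem atSite_one (i : ι) : atSite i (1 : Matrix (m i) (m i) ℂ) = 1 := by
  rw [atSite, Function.update_eq_self i (fun k => (1 : Matrix (m k) (m k) ℂ)), tensorMat_one]

theorem conjTranspose_atSite (i : ι) (M : Matrix (m i) (m i) ℂ) :
    (atSite i M)ᴴ = atSite i Mᴴ := by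
  rw [atSite, conjTranspose_tensorMat, atSite]
  congr 1; ext1 k
  by_cases h : k = i
  · subst h; simp
  · simp [h]

theorem onSites_eq_one {s : Finset ι} {M : ∀ i, Matrix (m i) (m i) ℂ} (h : ∀ i ∈ s, M i = 1) :
    onSites s M = 1 := by
  rw [onSites, ← tensorMat_one]
  congr 1; ext1 i
  split_ifs with hi
  · exact h i hi
  · rfl

variable [∀ i, Fintype (m i)]

theorem onSites_mul_onSites (s : Finset ι) (M N : ∀ i, Matrix (m i) (m i) ℂ) :
    onSites s M * onSites s N = onSites s fun i => M i * N i := by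
  rw [onSites, onSites, tensorMat_mul, onSites]
  congr 1; ext1 i
  split_ifs <;> simp

theorem onSites_union {s t : Finset ι} (h : Disjoint s t) (M : ∀ i, Matrix (m i) (m i) ℂ) :
    onSites (s ∪ t) M = onSites s M * onSites t M := by
  simp only [onSites, tensorMat_mul]
  congr 1; ext1 i
  by_cases hs : i ∈ s
  · simp [hs, Finset.disjoint_left.mp h hs]
  · simp [hs]

theorem commute_onSites {s t : Finset ι} (h : Disjoint s t) (M N : ∀ i, Matrix (m i) (m i) ℂ) :
    Commute (onSites s M) (onSites t N) := by
  simp only [Commute, SemiconjBy, onSites, tensorMat_mul]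
  congr 1; ext1 i
  by_cases hs : i ∈ s
  · simp [hs, Finset.disjoint_left.mp h hs]
  · simp [hs]

theorem atSite_mul (i : ι) (M N : Matrix (m i) (m i) ℂ) :
    atSite i (M * N) = atSite i M * atSite i N := by
  simp only [atSite, tensorMat_mul]
  congr 1; ext1 k
  by_cases h : k = i
  · subst h; simp
  · simp [h]

theorem commute_atSite_onSites {s : Finset ι} {i : ι} (h : i ∉ s) (A : Matrix (m i) (m i) ℂ)
    (M : ∀ i, Matrix (m i) (m i) ℂ) : Commute (atSite i A) (onSites s M) := by
  have := commute_onSites (s := {i}) (t := s) (by simpa using h)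
    (Function.update M i A) M
  rwa [onSites_singleton, Function.update_self] at this

theorem onSites_eq_atSite_mul {s : Finset ι} {i : ι} (h : i ∈ s)
    (M : ∀ i, Matrix (m i) (m i) ℂ) :
    onSites s M = atSite i (M i) * onSites (s.erase i) M := by
  rw [← onSites_singleton, ← onSites_union (by simp)]
  congr 1
  rw [← Finset.insert_eq, Finset.insert_erase h]

end TensorMat

/-! ### The action of operators on states -/

section Act

variable {m n p : Type*} [Fintype n] {E : Type*} [NormedAddCommGroup E] [InnerProductSpace ℂ E]

theorem act_apply (M : Matrix m n ℂ) (φ : PiLp 2 (fun _ : n => E)) (x : m) :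
    act M φ x = ∑ y, M x y • φ y := rfl

theorem act_mul [Fintype p] (M : Matrix m n ℂ) (N : Matrix n p ℂ) (φ : PiLp 2 (fun _ : p => E)) :
    act (M * N) φ = act M (act N φ) := by
  ext x
  simp only [act_apply, Matrix.mul_apply, Finset.sum_smul, Finset.smul_sum, mul_smul]
  exact Finset.sum_comm

theorem act_one [DecidableEq n] (φ : PiLp 2 (fun _ : n => E)) : act 1 φ = φ := by
  ext x
  simp [act_apply, Matrix.one_apply]

theorem act_add (M N : Matrix m n ℂ) (φ : PiLp 2 (fun _ : n => E)) :
    act (M + N) φ = act M φ + act N φ := by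
  ext x
  simp [act_apply, add_smul, Finset.sum_add_distrib]

theorem act_sub (M N : Matrix m n ℂ) (φ : PiLp 2 (fun _ : n => E)) :
    act (M - N) φ = act M φ - act N φ := by
  ext x
  simp [act_apply, sub_smul, Finset.sum_sub_distrib]

theorem act_smul (c : ℂ) (M : Matrix m n ℂ) (φ : PiLp 2 (fun _ : n => E)) :
    act (c • M) φ = c • act M φ := by
  ext x
  simp [act_apply, Finset.smul_sum, mul_smul]

theorem act_sum {κ : Type*} (s : Finset κ) (M : κ → Matrix m n ℂ) (φ : PiLp 2 (fun _ : n => E)) :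
    act (∑ k ∈ s, M k) φ = ∑ k ∈ s, act (M k) φ := by
  classical
  induction s using Finset.induction_on with
  | empty => ext x; simp [act_apply]
  | insert a s ha ih => rw [Finset.sum_insert ha, Finset.sum_insert ha, act_add, ih]

theorem act_zero_right (M : Matrix m n ℂ) : act M (0 : PiLp 2 (fun _ : n => E)) = 0 := by
  ext x
  simp [act_apply]

theorem inner_act [Fintype m] (M : Matrix m n ℂ) (φ : PiLp 2 (fun _ : m => E))
    (χ : PiLp 2 (fun _ : n => E)) : inner ℂ φ (act M χ) = inner ℂ (act Mᴴ φ) χ := by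
  simp only [PiLp.inner_apply, act_apply, inner_sum, sum_inner, inner_smul_left,
    inner_smul_right, Matrix.conjTranspose_apply, RCLike.star_def, RCLike.conj_conj]
  exact Finset.sum_comm

end Act

section Local

variable {ι : Type*} [Fintype ι] [DecidableEq ι] {m : ι → Type*} [∀ i, DecidableEq (m i)]
  [∀ i, Fintype (m i)] {E : Type*} [NormedAddCommGroup E] [InnerProductSpace ℂ E]

/-- If every one-site factor fixes the state, so does their tensor product. -/
theorem act_onSites_eq_self {M : ∀ i, Matrix (m i) (m i) ℂ} {φ : PiLp 2 (fun _ : (∀ i, m i) => E)}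
    (s : Finset ι) (h : ∀ i ∈ s, act (atSite i (M i)) φ = φ) : act (onSites s M) φ = φ := by
  induction s using Finset.induction_on with
  | empty => rw [onSites_empty, act_one]
  | insert a s ha ih =>
    rw [onSites_eq_atSite_mul (Finset.mem_insert_self a s), Finset.erase_insert ha, act_mul,
      ih fun i hi => h i (Finset.mem_insert_of_mem hi), h a (Finset.mem_insert_self a s)]

theorem act_atSite_apply (i : ι) (M : Matrix (m i) (m i) ℂ) (φ : PiLp 2 (fun _ : (∀ i, m i) => E))
    (x : ∀ i, m i) :
    act (atSite i M) φ x = ∑ c, M (x i) c • φ (Function.update x i c) := by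
  rw [act_apply]
  symm
  refine Finset.sum_of_injOn (fun c => Function.update x i c)
    (fun c _ c' _ h => by simpa using congrFun h i)
    (fun _ _ => Finset.mem_coe.2 (Finset.mem_univ _)) ?_ ?_
  · intro y _ hy
    suffices atSite i M x y = 0 by rw [this, zero_smul]
    rw [atSite_apply]
    obtain ⟨k, hk, hxy⟩ : ∃ k, k ≠ i ∧ x k ≠ y k := by
      by_contra! hcon
      refine hy ⟨y i, Finset.mem_coe.2 (Finset.mem_univ _), ?_⟩
      ext k
      by_cases hk : k = i
      · subst hk; simp
      · simp [hk, hcon k hk]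
    rw [Finset.prod_eq_zero (i := k) (by simpa using hk) (by simp [hxy]), mul_zero]
  · intro c _
    rw [atSite_apply, Finset.prod_eq_one]
    · simp
    · intro k hk
      rw [Function.update_of_ne (by simpa using hk), Matrix.one_apply_eq]

end Local

/-! ### Reduced states -/

section Reduced

variable {ι : Type*} [Fintype ι] [DecidableEq ι] {m : ι → Type*} [∀ i, DecidableEq (m i)]
  [∀ i, Fintype (m i)] {E : Type*} [NormedAddCommGroup E] [InnerProductSpace ℂ E]

/-- The reduced density matrix at site `i` of a vector of `(⨂ i, ℂ ^ (m i)) ⊗ E`, with the same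
encoding as `Realization.reducedState`. -/
def reduced (φ : PiLp 2 (fun _ : (∀ i, m i) => E)) (i : ι) : Matrix (m i) (m i) ℂ :=
  Matrix.of fun a b => ∑ x : (∀ k, m k) with x i = a, inner ℂ (φ (Function.update x i b)) (φ x)

/-- The defining property of the reduced state: it gives the expectation values of all operators
of its site. -/
theorem trace_reduced_mul (φ : PiLp 2 (fun _ : (∀ i, m i) => E)) (i : ι)
    (M : Matrix (m i) (m i) ℂ) :
    (reduced φ i * M).trace = inner ℂ φ (act (atSite i M) φ) := by
  have h1 : (reduced φ i * M).trace =
      ∑ q : (∀ k, m k) × m i, M q.2 (q.1 i) * inner ℂ (φ (Function.update q.1 i q.2)) (φ q.1) := by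
    rw [Fintype.sum_prod_type]
    simp only [Matrix.trace, Matrix.diag_apply, Matrix.mul_apply, reduced, Matrix.of_apply,
      Finset.sum_mul]
    simp only [Finset.sum_filter]
    rw [Finset.sum_congr rfl fun a _ => Finset.sum_comm, Finset.sum_comm]
    refine Finset.sum_congr rfl fun x _ => ?_
    rw [Finset.sum_comm]
    refine Finset.sum_congr rfl fun b _ => ?_
    rw [Finset.sum_eq_single (x i) (fun a _ ha => by simp [Ne.symm ha]) (by simp)]
    simp [mul_comm]
  have h2 : inner ℂ φ (act (atSite i M) φ) =
      ∑ q : (∀ k, m k) × m i, M (q.1 i) q.2 * inner ℂ (φ q.1) (φ (Function.update q.1 i q.2)) := by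
    rw [Fintype.sum_prod_type]
    simp only [PiLp.inner_apply, act_atSite_apply, inner_sum, inner_smul_right]
  rw [h1, h2]
  -- exchange the value at site `i` with the summation variable
  let σ : (∀ k, m k) × m i → (∀ k, m k) × m i := fun q => (Function.update q.1 i q.2, q.1 i)
  have hσ : Function.Involutive σ := fun q => by simp [σ]
  refine Fintype.sum_equiv hσ.toPerm _ _ fun q => ?_
  simp [σ]

theorem reduced_mul_eq_zero {φ : PiLp 2 (fun _ : (∀ i, m i) => E)} {i : ι}
    {M : Matrix (m i) (m i) ℂ} (h : act (atSite i M) φ = 0) : M * reduced φ i = 0 := by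
  refine Matrix.ext_iff_trace_mul_right.2 fun N => ?_
  rw [Matrix.mul_assoc, Matrix.trace_mul_comm, Matrix.mul_assoc, trace_reduced_mul, atSite_mul,
    act_mul, h, act_zero_right]
  simp

theorem reduced_mul_eq_self {φ : PiLp 2 (fun _ : (∀ i, m i) => E)} {i : ι}
    {M : Matrix (m i) (m i) ℂ} (h : act (atSite i M) φ = φ) : M * reduced φ i = reduced φ i := by
  have : (M - 1) * reduced φ i = 0 :=
    reduced_mul_eq_zero (by rw [atSite_sub, act_sub, h, atSite_one, act_one, sub_self])
  rwa [sub_mul, one_mul, sub_eq_zero] at this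

theorem act_atSite_eq_self {φ : PiLp 2 (fun _ : (∀ i, m i) => E)} {i : ι}
    {M : Matrix (m i) (m i) ℂ} (h : M * reduced φ i = reduced φ i) : act (atSite i M) φ = φ := by
  have h0 : (M - 1) * reduced φ i = 0 := by rw [sub_mul, h, one_mul, sub_self]
  have h1 : act (atSite i (M - 1)) φ = 0 := by
    rw [← inner_self_eq_zero (𝕜 := ℂ), inner_act, ← act_mul, conjTranspose_atSite, ← atSite_mul,
      ← inner_conj_symm, ← trace_reduced_mul, ← Matrix.mul_assoc, Matrix.trace_mul_comm,
      ← Matrix.mul_assoc, h0]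
    simp
  rwa [atSite_sub, act_sub, atSite_one, act_one, sub_eq_zero] at h1

/-- An operator of one site that acts on the state like a Hermitian operator of the other sites
commutes with the reduced state. -/
theorem commute_reduced {φ : PiLp 2 (fun _ : (∀ i, m i) => E)} {i : ι}
    {A : Matrix (m i) (m i) ℂ} (hA : A.IsHermitian) {s : Finset ι} (hi : i ∉ s)
    {M : ∀ i, Matrix (m i) (m i) ℂ} (hM : ∀ i, (M i).IsHermitian)
    (h : act (atSite i A) φ = act (onSites s M) φ) : A * reduced φ i = reduced φ i * A := by
  refine Matrix.ext_iff_trace_mul_right.2 fun N => ?_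
  have hW : (onSites s M)ᴴ = onSites s M := by
    rw [conjTranspose_onSites]; congr 1; ext1 k; exact hM k
  have hA' : (atSite i A)ᴴ = atSite i A := by rw [conjTranspose_atSite, hA.eq]
  rw [Matrix.mul_assoc, Matrix.trace_mul_comm, Matrix.mul_assoc, Matrix.mul_assoc,
    trace_reduced_mul, trace_reduced_mul, atSite_mul, atSite_mul, act_mul, h, ← act_mul,
    (commute_atSite_onSites hi N M).eq, act_mul, inner_act, hW, ← h, act_mul, ← hA', ← inner_act,
    hA']

end Reduced

/-! ### One party: two anticommuting involutions on a subspace -/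

section OneParty

open Matrix

variable {n : Type*} [Fintype n] [DecidableEq n]

/-- If the Hermitian matrices `X` and `Z` preserve the range of `ρ`, and square to `1` and
anticommute there, then that range is `ℂ² ⊗ ℂ ^ d` with `X` and `Z` acting as Pauli matrices:
an orthonormal basis `e k` of the `+1` eigenspace of `Z` is completed by the vectors `X e k`. -/
theorem exists_pauli_frame {X Z ρ : Matrix n n ℂ} (hX : X.IsHermitian) (hZ : Z.IsHermitian)
    (hXρ : X * ρ = ρ * X) (hZρ : Z * ρ = ρ * Z) (hXX : X * X * ρ = ρ) (hZZ : Z * Z * ρ = ρ)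
    (hXZ : (X * Z + Z * X) * ρ = 0) :
    ∃ (d : ℕ) (U : Matrix (Fin 2 × Fin d) n ℂ), U * Uᴴ = 1 ∧
      LinearMap.range Uᴴ.mulVecLin = LinearMap.range ρ.mulVecLin ∧
      U * X = (pauliX ⊗ₖ (1 : Matrix (Fin d) (Fin d) ℂ)) * U ∧
      U * Z = (pauliZ ⊗ₖ (1 : Matrix (Fin d) (Fin d) ℂ)) * U := by
  set V : Submodule ℂ (n → ℂ) := LinearMap.range ρ.mulVecLin with hV
  have mX : ∀ v ∈ V, X *ᵥ v ∈ V := by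
    rintro _ ⟨w, rfl⟩
    exact ⟨X *ᵥ w, by simp [hXρ]⟩
  have mZ : ∀ v ∈ V, Z *ᵥ v ∈ V := by
    rintro _ ⟨w, rfl⟩
    exact ⟨Z *ᵥ w, by simp [hZρ]⟩
  have sX : ∀ v ∈ V, X *ᵥ (X *ᵥ v) = v := by
    rintro _ ⟨w, rfl⟩
    simp only [mulVecLin_apply, mulVec_mulVec, ← Matrix.mul_assoc, hXX]
  have sZ : ∀ v ∈ V, Z *ᵥ (Z *ᵥ v) = v := by
    rintro _ ⟨w, rfl⟩
    simp only [mulVecLin_apply, mulVec_mulVec, ← Matrix.mul_assoc, hZZ]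
  have aXZ : ∀ v ∈ V, Z *ᵥ (X *ᵥ v) = -(X *ᵥ (Z *ᵥ v)) := by
    rintro _ ⟨w, rfl⟩
    rw [eq_neg_iff_add_eq_zero, add_comm]
    simp only [mulVecLin_apply, mulVec_mulVec, ← Matrix.mul_assoc, ← add_mulVec, ← add_mul, hXZ,
      zero_mulVec]
  let W : Submodule ℂ (EuclideanSpace ℂ n) :=
    { carrier := {v | v.ofLp ∈ V ∧ Z *ᵥ v.ofLp = v.ofLp}
      add_mem' := fun {a b} ha hb => ⟨V.add_mem ha.1 hb.1, by
        rw [WithLp.ofLp_add, mulVec_add, ha.2, hb.2]⟩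
      zero_mem' := ⟨V.zero_mem, by simp⟩
      smul_mem' := fun c a ha => ⟨V.smul_mem c ha.1, by
        rw [WithLp.ofLp_smul, mulVec_smul, ha.2]⟩ }
  let b := stdOrthonormalBasis ℂ W
  set d := Module.finrank ℂ W
  let e : Fin d → n → ℂ := fun k => (b k : EuclideanSpace ℂ n).ofLp
  have heV : ∀ k, e k ∈ V := fun k => (b k).2.1
  have heZ : ∀ k, Z *ᵥ e k = e k := fun k => (b k).2.2
  have hee : ∀ k l, star (e k) ⬝ᵥ e l = if k = l then 1 else 0 := by
    intro k l
    have := orthonormal_iff_ite.1 b.orthonormal k l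
    rw [← this, Submodule.coe_inner, EuclideanSpace.inner_eq_star_dotProduct, dotProduct_comm]
  -- Hermitian matrices move to the other side of the inner product
  have adj : ∀ {A : Matrix n n ℂ}, A.IsHermitian → ∀ v w : n → ℂ,
      star (A *ᵥ v) ⬝ᵥ w = star v ⬝ᵥ (A *ᵥ w) := by
    intro A hA v w
    rw [star_mulVec, hA.eq, dotProduct_mulVec]
  let f : Fin 2 × Fin d → n → ℂ := fun q => if q.1 = 0 then e q.2 else X *ᵥ e q.2
  have hfV : ∀ q, f q ∈ V := by
    intro q
    by_cases hq : q.1 = 0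
    · simpa [f, hq] using heV q.2
    · simpa [f, hq] using mX _ (heV q.2)
  -- `X` maps the `+1` eigenspace of `Z` to the `-1` eigenspace, which is orthogonal to it
  have hcross : ∀ k l, star (e k) ⬝ᵥ (X *ᵥ e l) = 0 := by
    intro k l
    have h1 : star (e k) ⬝ᵥ (X *ᵥ e l) = -(star (e k) ⬝ᵥ (X *ᵥ e l)) := by
      conv_lhs => rw [← heZ k, adj hZ, aXZ _ (heV l), heZ l, dotProduct_neg]
    exact self_eq_neg.1 h1
  let U : Matrix (Fin 2 × Fin d) n ℂ := Matrix.of fun q => star (f q)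
  have hUH : ∀ w, Uᴴ *ᵥ w = ∑ q, w q • f q := by
    intro w
    ext a
    have hU : ∀ q, Uᴴ a q = f q a := fun q => star_star (f q a)
    simp only [mulVec, dotProduct, hU, Finset.sum_apply, Pi.smul_apply, smul_eq_mul]
    exact Finset.sum_congr rfl fun q _ => mul_comm _ _
  have hrow : ∀ {A : Matrix n n ℂ}, A.IsHermitian → ∀ q a, (U * A) q a = star ((A *ᵥ f q) a) := by
    intro A hA q a
    rw [← Pi.star_apply, star_mulVec, hA.eq]
    rfl
  refine ⟨d, U, ?_, ?_, ?_, ?_⟩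
  · ext ⟨s, k⟩ ⟨t, l⟩
    have : (U * Uᴴ) (s, k) (t, l) = star (f (s, k)) ⬝ᵥ f (t, l) := by
      rw [Matrix.mul_apply]
      exact Finset.sum_congr rfl fun a _ => congrArg _ (star_star (f (t, l) a))
    rw [this, Matrix.one_apply]
    fin_cases s <;> fin_cases t
    · simp [f, hee]
    · simp [f, hcross]
    · simp [f, adj hX, hcross]
    · simp [f, adj hX, sX _ (heV l), hee]
  · apply le_antisymm
    · rintro _ ⟨w, rfl⟩
      rw [mulVecLin_apply, hUH]
      exact Submodule.sum_mem _ fun q _ => V.smul_mem _ (hfV q)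
    · have hW : ∀ v ∈ V, Z *ᵥ v = v → ∃ c : Fin d → ℂ, v = ∑ k, c k • e k := by
        intro v hv hvZ
        let v' : W := ⟨WithLp.toLp 2 v, hv, hvZ⟩
        refine ⟨fun k => b.repr v' k, ?_⟩
        have := congrArg (fun u : W => (u : EuclideanSpace ℂ n).ofLp) (b.sum_repr v')
        rw [show v = (v' : EuclideanSpace ℂ n).ofLp from rfl, ← this]
        simp [e]
      -- split `v` into its components in the two eigenspaces of `Z`, and move the second one by `X`
      intro v hv
      obtain ⟨c₀, h₀⟩ := hW ((2⁻¹ : ℂ) • (v + Z *ᵥ v))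
        (V.smul_mem _ (V.add_mem hv (mZ v hv))) (by
          rw [mulVec_smul, mulVec_add, sZ v hv, add_comm])
      obtain ⟨c₁, h₁⟩ := hW (X *ᵥ ((2⁻¹ : ℂ) • (v - Z *ᵥ v)))
        (mX _ (V.smul_mem _ (V.sub_mem hv (mZ v hv)))) (by
          rw [aXZ _ (V.smul_mem _ (V.sub_mem hv (mZ v hv))), mulVec_smul, mulVec_sub, sZ v hv,
            ← mulVec_neg, ← smul_neg, neg_sub])
      refine ⟨fun q => if q.1 = 0 then c₀ q.2 else c₁ q.2, ?_⟩
      rw [mulVecLin_apply, hUH, Fintype.sum_prod_type, Fin.sum_univ_two]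
      have h₁' : (2⁻¹ : ℂ) • (v - Z *ᵥ v) = ∑ k, c₁ k • (X *ᵥ e k) := by
        rw [← sX _ (V.smul_mem _ (V.sub_mem hv (mZ v hv))), h₁, mulVec_sum]
        simp [mulVec_smul]
      simp only [f, if_true, one_ne_zero, if_false]
      rw [← h₀, ← h₁']
      module
  · ext ⟨s, k⟩ a
    rw [hrow hX]
    simp only [Matrix.mul_apply, Fintype.sum_prod_type, kroneckerMap_apply, Fin.sum_univ_two,
      Matrix.one_apply, pauliX, U, Matrix.of_apply]
    fin_cases s <;> simp [f, sX _ (heV k)]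
  · ext ⟨s, k⟩ a
    rw [hrow hZ]
    simp only [Matrix.mul_apply, Fintype.sum_prod_type, kroneckerMap_apply, Fin.sum_univ_two,
      Matrix.one_apply, pauliZ, U, Matrix.of_apply]
    fin_cases s <;> simp [f, heZ k, aXZ _ (heV k)]

end OneParty

/-! ### Incidence on the torus -/

section Lattice

variable {L : ℕ}

/-- Every edge `i` meets exactly two vertices: `i.1` and `i.headSite`. -/
def headSite (i : Qubit L) : Site L :=
  if i.2 then (i.1.1, i.1.2 + 1) else (i.1.1 + 1, i.1.2)

/-- Every edge `i` bounds exactly two plaquettes: `i.1` and `coheadSite i`. -/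
def coheadSite (i : Qubit L) : Site L :=
  if i.2 then (i.1.1 - 1, i.1.2) else (i.1.1, i.1.2 - 1)

theorem mem_starOf {i : Qubit L} {v : Site L} : i ∈ starOf v ↔ v = i.1 ∨ v = headSite i := by
  obtain ⟨⟨x, y⟩, b⟩ := i
  obtain ⟨a, c⟩ := v
  cases b <;> simp [starOf, headSite, eq_sub_iff_add_eq] <;> grind

theorem mem_boundaryOf {i : Qubit L} {p : Site L} :
    i ∈ boundaryOf p ↔ p = i.1 ∨ p = coheadSite i := by
  obtain ⟨⟨x, y⟩, b⟩ := i
  obtain ⟨a, c⟩ := p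
  cases b <;> simp [boundaryOf, coheadSite, eq_sub_iff_add_eq] <;> grind

theorem starOf_inter_boundaryOf_self (x y : ZMod L) (e : Qubit L) (h : e ∈ starOf (x, y))
    (h' : e ∈ boundaryOf (x, y)) : e = ((x, y), false) ∨ e = ((x, y), true) := by
  obtain ⟨⟨a, b⟩, _ | _⟩ := e <;> simp [starOf, boundaryOf] at h h' ⊢ <;> grind

theorem starOf_inter_boundaryOf_right (x y : ZMod L) (e : Qubit L) (h : e ∈ starOf (x + 1, y))
    (h' : e ∈ boundaryOf (x, y)) : e = ((x, y), false) ∨ e = ((x + 1, y), true) := by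
  obtain ⟨⟨a, b⟩, _ | _⟩ := e <;> simp [starOf, boundaryOf] at h h' ⊢ <;> grind

theorem starOf_inter_boundaryOf_top (x y : ZMod L) (e : Qubit L) (h : e ∈ starOf (x, y + 1))
    (h' : e ∈ boundaryOf (x, y)) : e = ((x, y + 1), false) ∨ e = ((x, y), true) := by
  obtain ⟨⟨a, b⟩, _ | _⟩ := e <;> simp [starOf, boundaryOf] at h h' ⊢ <;> grind

theorem zmod_induction [NeZero L] {P : ZMod L → Prop} (h : ∀ x, P x → P (x + 1))
    {a : ZMod L} (ha : P a) (b : ZMod L) : P b := by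
  have key : ∀ k : ℕ, P (a + k) := by
    intro k
    induction k with
    | zero => simpa using ha
    | succ k ih => simpa [add_assoc] using h _ ih
  simpa using key (b - a).val

/-- The torus is connected: unit steps lead from any site to any other. -/
theorem site_induction [NeZero L] {P : Site L → Prop} (h₁ : ∀ x y, P (x, y) → P (x + 1, y))
    (h₂ : ∀ x y, P (x, y) → P (x, y + 1)) {a : Site L} (ha : P a) (b : Site L) : P b :=
  zmod_induction (P := fun y => P (b.1, y)) (fun y => h₂ _ y)
    (zmod_induction (P := fun x => P (x, a.2)) (fun x => h₁ x _) ha b.1) b.2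

variable [Fact (1 < L)]

theorem headSite_ne (i : Qubit L) : headSite i ≠ i.1 := by
  obtain ⟨⟨x, y⟩, b⟩ := i
  cases b <;> simp [headSite]

theorem coheadSite_ne (i : Qubit L) : coheadSite i ≠ i.1 := by
  obtain ⟨⟨x, y⟩, b⟩ := i
  cases b <;> simp [coheadSite]

theorem prod_boundaryOf {M : Type*} [CommMonoid M] (F : Qubit L → M) (p : Site L) :
    ∏ i ∈ boundaryOf p, F i = F ((p.1, p.2), false) * F ((p.1, p.2 + 1), false) *
      F ((p.1, p.2), true) * F ((p.1 + 1, p.2), true) := by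
  obtain ⟨x, y⟩ := p
  rw [boundaryOf, Finset.prod_insert (by simp), Finset.prod_insert (by simp),
    Finset.prod_insert (by simp), Finset.prod_singleton]
  simp only [mul_assoc]

variable [NeZero L]

theorem card_filter_mem_starOf (i : Qubit L) :
    (Finset.univ.filter fun v => i ∈ starOf v).card = 2 := by
  have : (Finset.univ.filter fun v => i ∈ starOf v) = {i.1, headSite i} := by
    ext v; simp [mem_starOf]
  rw [this, Finset.card_pair (headSite_ne i).symm]

theorem card_filter_mem_boundaryOf (i : Qubit L) :
    (Finset.univ.filter fun p => i ∈ boundaryOf p).card = 2 := by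
  have : (Finset.univ.filter fun p => i ∈ boundaryOf p) = {i.1, coheadSite i} := by
    ext v; simp [mem_boundaryOf]
  rw [this, Finset.card_pair (coheadSite_ne i).symm]

end Lattice

/-! ### The dimension of the code space -/

section Code

variable {L : ℕ}

/-- The number modulo two of the elements of a set of sites, with indicator function `f`, that
an edge touches; its sites are `i.1` and `head i`. -/
def coboundary (head : Qubit L → Site L) (f : Site L → ZMod 2) (i : Qubit L) : ZMod 2 :=
  f i.1 + f (head i)

/-- The one-qubit operator `X ^ a * Z ^ b`. -/
def pauli (a b : ZMod 2) : Matrix (Fin 2) (Fin 2) ℂ :=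
  (if a = 0 then 1 else pauliX) * (if b = 0 then 1 else pauliZ)

/-- The character `(-1) ^ a`. -/
def sign (a : ZMod 2) : ℂ := if a = 0 then 1 else -1

theorem zmod_two_cases (a : ZMod 2) : a = 0 ∨ a = 1 := by
  revert a; decide

theorem sign_add (a b : ZMod 2) : sign (a + b) = sign a * sign b := by
  rcases zmod_two_cases a with rfl | rfl <;> rcases zmod_two_cases b with rfl | rfl <;>
    simp [sign, CharTwo.add_self_eq_zero]

theorem sign_mul_self (a : ZMod 2) : sign a * sign a = 1 := by
  rw [← sign_add, CharTwo.add_self_eq_zero, sign, if_pos rfl]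

theorem pauliX_mul_self : pauliX * pauliX = 1 := by
  ext i k; fin_cases i <;> fin_cases k <;> simp [pauliX]

theorem pauliZ_mul_self : pauliZ * pauliZ = 1 := by
  ext i k; fin_cases i <;> fin_cases k <;> simp [pauliZ]

theorem pauliZ_mul_pauliX : pauliZ * pauliX = -(pauliX * pauliZ) := by
  ext i k; fin_cases i <;> fin_cases k <;> simp [pauliZ, pauliX]

theorem pauliX_mul_pauli (a b : ZMod 2) : pauliX * pauli a b = pauli (a + 1) b := by
  rcases zmod_two_cases a with rfl | rfl
  · simp [pauli]
  · simp [pauli, CharTwo.add_self_eq_zero, ← mul_assoc, pauliX_mul_self]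

theorem pauliZ_mul_pauli (a b : ZMod 2) : pauliZ * pauli a b = sign a • pauli a (b + 1) := by
  rcases zmod_two_cases a with rfl | rfl <;> rcases zmod_two_cases b with rfl | rfl <;>
    simp [pauli, sign, CharTwo.add_self_eq_zero, pauliZ_mul_self, ← mul_assoc, pauliZ_mul_pauliX]
  simp [mul_assoc, pauliZ_mul_self]

theorem trace_pauli (a b : ZMod 2) :
    (pauli a b).trace = (if a = 0 then 2 else 0) * (if b = 0 then 1 else 0) := by
  rcases zmod_two_cases a with rfl | rfl <;> rcases zmod_two_cases b with rfl | rfl <;>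
    simp [pauli, Matrix.trace, pauliX, pauliZ, Fin.sum_univ_two]

theorem toEuclideanLin_eq_act {n : Type*} [Fintype n] [DecidableEq n] (M : Matrix n n ℂ)
    (ψ : EuclideanSpace ℂ n) : Matrix.toEuclideanLin M ψ = act M ψ := by
  ext x
  simp [act_apply, Matrix.toLpLin_apply, Matrix.mulVec, dotProduct]

theorem coboundary_add_single {head : Qubit L → Site L} (hh : ∀ i, head i ≠ i.1)
    (f : Site L → ZMod 2) (v : Site L) (i : Qubit L) :
    coboundary head (f + Pi.single v 1) i =
      if v = i.1 ∨ v = head i then coboundary head f i + 1 else coboundary head f i := by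
  have := hh i
  by_cases h1 : v = i.1
  · subst h1
    simp [coboundary, this, add_right_comm]
  · by_cases h2 : v = head i
    · subst h2
      simp [coboundary, Ne.symm this, add_assoc]
    · simp [coboundary, h1, h2, Ne.symm h1, Ne.symm h2]

variable [NeZero L]

/-- The product of the vertex operators of the set with indicator function `f` and the plaquette
operators of the set with indicator function `g`. -/
def stabilizer (f g : Site L → ZMod 2) : Matrix (Qubit L → Fin 2) (Qubit L → Fin 2) ℂ :=
  tensorMat fun i => pauli (coboundary headSite f i) (coboundary coheadSite g i)

theorem stabilizer_zero : stabilizer (0 : Site L → ZMod 2) 0 = 1 := by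
  rw [← tensorMat_one]
  simp [stabilizer, coboundary, pauli]

theorem mem_codeSpace {ψ : EuclideanSpace ℂ (Qubit L → Fin 2)} :
    ψ ∈ codeSpace L ↔
      (∀ v, act (vertexOp v) ψ = ψ) ∧ ∀ p, act (plaquetteOp p) ψ = ψ := by
  simp [codeSpace, Submodule.mem_inf, Submodule.mem_iInf, toEuclideanLin_eq_act]

theorem indicator_induction {P : (Site L → ZMod 2) → Prop} (h0 : P 0)
    (h : ∀ f v, P f → P (f + Pi.single v 1)) (f : Site L → ZMod 2) : P f := by
  have key : ∀ s : Finset (Site L), P (∑ v ∈ s, Pi.single v 1) := by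
    intro s
    induction s using Finset.induction_on with
    | empty => simpa using h0
    | insert a s ha ih =>
      rw [Finset.sum_insert ha, add_comm]
      exact h _ _ ih
  have hf : f = ∑ v with f v ≠ 0, Pi.single v (1 : ZMod 2) := by
    conv_lhs => rw [← Finset.univ_sum_single f]
    rw [Finset.sum_filter]
    refine Finset.sum_congr rfl fun v _ => ?_
    rcases zmod_two_cases (f v) with hv | hv <;> simp [hv]
  rw [hf]
  exact key _

/-- If only constant functions take equal values at the two sites of each edge, then the sets
without coboundary are the empty and the full set. -/
theorem card_coboundary_eq_zero {head : Qubit L → Site L}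
    (hc : ∀ f : Site L → ZMod 2, (∀ i, f i.1 = f (head i)) → ∀ a, f a = f 0) :
    (Finset.univ.filter fun f : Site L → ZMod 2 => ∀ i, coboundary head f i = 0).card = 2 := by
  have : (Finset.univ.filter fun f : Site L → ZMod 2 => ∀ i, coboundary head f i = 0) =
      {0, 1} := by
    ext f
    simp only [Finset.mem_filter, Finset.mem_univ, true_and, Finset.mem_insert,
      Finset.mem_singleton, coboundary, CharTwo.add_eq_zero]
    constructor
    · intro h
      have hf := hc f h
      rcases zmod_two_cases (f 0) with h0 | h0
      · exact Or.inl (funext fun a => by rw [hf, h0, Pi.zero_apply])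
      · exact Or.inr (funext fun a => by rw [hf, h0, Pi.one_apply])
    · rintro (rfl | rfl) <;> simp
  rw [this, Finset.card_pair zero_ne_one]

theorem card_headSite : (Finset.univ.filter fun f : Site L → ZMod 2 =>
    ∀ i, coboundary headSite f i = 0).card = 2 :=
  card_coboundary_eq_zero fun f hf a =>
    site_induction (P := fun a => f a = f 0)
      (fun x y h => (hf ((x, y), false)).symm.trans h)
      (fun x y h => (hf ((x, y), true)).symm.trans h) rfl a

theorem card_coheadSite : (Finset.univ.filter fun f : Site L → ZMod 2 =>
    ∀ i, coboundary coheadSite f i = 0).card = 2 :=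
  card_coboundary_eq_zero fun f hf a =>
    site_induction (P := fun a => f a = f 0)
      (fun x y h => by simpa [coheadSite, h] using hf ((x + 1, y), true))
      (fun x y h => by simpa [coheadSite, h] using hf ((x, y + 1), false)) rfl a

theorem trace_stabilizer (f g : Site L → ZMod 2) : (stabilizer f g).trace =
    (if ∀ i, coboundary headSite f i = 0 then 2 ^ Fintype.card (Qubit L) else 0) *
      (if ∀ i, coboundary coheadSite g i = 0 then 1 else 0) := by
  simp only [stabilizer, trace_tensorMat, trace_pauli, Finset.prod_mul_distrib,
    Finset.prod_ite_zero, Finset.mem_univ, true_imp_iff, Finset.prod_const, Finset.card_univ,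
    one_pow]

variable [Fact (1 < L)]

theorem vertexOp_mul_stabilizer (v : Site L) (f g : Site L → ZMod 2) :
    vertexOp v * stabilizer f g = stabilizer (f + Pi.single v 1) g := by
  rw [vertexOp, onSites, stabilizer, tensorMat_mul, stabilizer]
  congr 1; ext1 i
  rw [coboundary_add_single headSite_ne]
  by_cases h : v = i.1 ∨ v = headSite i
  · rw [if_pos (mem_starOf.2 h), if_pos h, pauliX_mul_pauli]
  · rw [if_neg (mt mem_starOf.1 h), if_neg h, one_mul]

/-- The plaquette operator of `p` commutes with all vertex operators: each corner of `p` lies on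
two edges of `p`, so that the signs cancel. -/
theorem prod_sign_coboundary (f : Site L → ZMod 2) (p : Site L) :
    ∏ i, (if i ∈ boundaryOf p then sign (coboundary headSite f i) else 1) = 1 := by
  rw [Finset.prod_ite_mem, Finset.univ_inter, prod_boundaryOf]
  simp only [coboundary, headSite, sign_add]
  have h := fun a => sign_mul_self (f a)
  simp only [if_true, Bool.false_eq_true, if_false]
  linear_combination (sign (f (p.1, p.2 + 1))) ^ 2 * sign (f (p.1 + 1, p.2)) ^ 2 *
      sign (f (p.1 + 1, p.2 + 1)) ^ 2 * h (p.1, p.2) +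
    sign (f (p.1 + 1, p.2)) ^ 2 * sign (f (p.1 + 1, p.2 + 1)) ^ 2 * h (p.1, p.2 + 1) +
    sign (f (p.1 + 1, p.2 + 1)) ^ 2 * h (p.1 + 1, p.2) + h (p.1 + 1, p.2 + 1)

theorem plaquetteOp_mul_stabilizer (p : Site L) (f g : Site L → ZMod 2) :
    plaquetteOp p * stabilizer f g = stabilizer f (g + Pi.single p 1) := by
  rw [plaquetteOp, onSites, stabilizer, tensorMat_mul, stabilizer, ← one_smul ℂ (tensorMat _),
    ← prod_sign_coboundary f p, ← tensorMat_smul]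
  congr 1; ext1 i
  rw [coboundary_add_single coheadSite_ne]
  by_cases h : p = i.1 ∨ p = coheadSite i
  · rw [if_pos (mem_boundaryOf.2 h), if_pos h, if_pos (mem_boundaryOf.2 h), pauliZ_mul_pauli,
      smul_smul, sign_mul_self, one_smul]
  · rw [if_neg (mt mem_boundaryOf.1 h), if_neg h, if_neg (mt mem_boundaryOf.1 h), one_mul, one_smul]

theorem act_stabilizer {ψ : EuclideanSpace ℂ (Qubit L → Fin 2)} (hψ : ψ ∈ codeSpace L)
    (f g : Site L → ZMod 2) : act (stabilizer f g) ψ = ψ := by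
  rw [mem_codeSpace] at hψ
  induction f using indicator_induction with
  | h0 =>
    induction g using indicator_induction with
    | h0 => rw [stabilizer_zero, act_one]
    | h g p ih => rw [← plaquetteOp_mul_stabilizer, act_mul, ih, hψ.2]
  | h f v ih => rw [← vertexOp_mul_stabilizer, act_mul, ih, hψ.1]

/-- The average of the stabilizer group is the projection onto the code space, and its trace is
computed from the trace of each stabilizer: only the four products that are trivial, as the sets
of vertices and of plaquettes are each empty or full, contribute. -/
theorem finrank_codeSpace : Module.finrank ℂ (codeSpace L) = 4 := by
  set A : Matrix (Qubit L → Fin 2) (Qubit L → Fin 2) ℂ :=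
    (2 ^ Fintype.card (Qubit L) : ℂ)⁻¹ • ∑ f : Site L → ZMod 2, ∑ g : Site L → ZMod 2,
      stabilizer f g with hA
  have hN : Fintype.card (Qubit L) = Fintype.card (Site L) + Fintype.card (Site L) := by
    rw [Fintype.card_prod, Fintype.card_bool, mul_two]
  have hproj : LinearMap.IsProj (codeSpace L) (Matrix.toEuclideanLin A) := by
    constructor
    · intro ψ
      rw [mem_codeSpace]
      constructor
      · intro v
        rw [toEuclideanLin_eq_act, ← act_mul, hA, Matrix.mul_smul, Finset.mul_sum]
        congr 2
        refine Fintype.sum_equiv (Equiv.addRight (Pi.single v 1)) _ _ fun f => ?_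
        rw [Finset.mul_sum]
        exact Finset.sum_congr rfl fun g _ => vertexOp_mul_stabilizer v f g
      · intro p
        rw [toEuclideanLin_eq_act, ← act_mul, hA, Matrix.mul_smul, Finset.mul_sum]
        congr 2
        refine Finset.sum_congr rfl fun f _ => ?_
        rw [Finset.mul_sum]
        refine Fintype.sum_equiv (Equiv.addRight (Pi.single p 1)) _ _ fun g => ?_
        exact plaquetteOp_mul_stabilizer p f g
    · intro ψ hψ
      rw [toEuclideanLin_eq_act, hA, act_smul, act_sum]
      simp only [act_sum, act_stabilizer hψ, Finset.sum_const, Finset.card_univ, Fintype.card_fun,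
        ZMod.card]
      rw [smul_smul, ← pow_add, ← hN, ← Nat.cast_smul_eq_nsmul ℂ, smul_smul]
      simp
  have htr : LinearMap.trace ℂ _ (Matrix.toEuclideanLin A) = A.trace := by
    rw [Matrix.toEuclideanLin, Matrix.toLpLin_eq_toLin, Matrix.trace_toLin_eq]
  have h4 : A.trace = 4 := by
    rw [hA, Matrix.trace_smul, Matrix.trace_sum]
    simp only [Matrix.trace_sum, trace_stabilizer, ← Finset.mul_sum, ← Finset.sum_mul]
    rw [← Finset.sum_filter, ← Finset.sum_filter, Finset.sum_const, Finset.sum_const,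
      card_headSite, card_coheadSite]
    simp
    field_simp
    norm_num
  have := hproj.trace
  rw [htr, h4] at this
  exact_mod_cast this.symm

end Code

/-! ### Expectation values as sums of squares -/

section Stabilized

variable {ι : Type*} [Fintype ι] [DecidableEq ι] {m : ι → Type*} [∀ i, DecidableEq (m i)]
  {E : Type*} [NormedAddCommGroup E] [InnerProductSpace ℂ E]

/-- The factor at site `j` of the operator `onSites s M`. -/
def pivot (j : ι) (s : Finset ι) (M : ∀ i, Matrix (m i) (m i) ℂ) :
    Matrix (∀ i, m i) (∀ i, m i) ℂ :=
  if j ∈ s then atSite j (M j) else 1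

variable {j : ι} {s : Finset ι} {M : ∀ i, Matrix (m i) (m i) ℂ}

theorem conjTranspose_pivot (hM : ∀ i, (M i).IsHermitian) : (pivot j s M)ᴴ = pivot j s M := by
  unfold pivot
  split_ifs
  · rw [conjTranspose_atSite, (hM j).eq]
  · exact Matrix.conjTranspose_one

theorem conjTranspose_onSites_of_isHermitian (hM : ∀ i, (M i).IsHermitian) :
    (onSites s M)ᴴ = onSites s M := by
  rw [conjTranspose_onSites]
  congr 1; ext1 k; exact hM k

variable [∀ i, Fintype (m i)] {φ : PiLp 2 (fun _ : (∀ i, m i) => E)}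

theorem pivot_mul_onSites_erase : pivot j s M * onSites (s.erase j) M = onSites s M := by
  by_cases h : j ∈ s
  · rw [pivot, if_pos h, onSites_eq_atSite_mul h]
  · rw [pivot, if_neg h, one_mul, Finset.erase_eq_of_notMem h]

theorem onSites_erase_mul_self (hsq : ∀ i, i ≠ j → M i * M i = 1) :
    onSites (s.erase j) M * onSites (s.erase j) M = 1 := by
  rw [onSites_mul_onSites, onSites_eq_one fun i hi => hsq i (Finset.ne_of_mem_erase hi)]

theorem commute_pivot_onSites_erase :
    Commute (pivot j s M) (onSites (s.erase j) M) := by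
  unfold pivot
  split_ifs
  · exact commute_atSite_onSites (Finset.notMem_erase j s) _ _
  · exact Commute.one_left _

/-- The expectation value of a product `P * Q` of the factor `P` at site `j` and of an involution
`Q` on the other sites, as a sum of squares. -/
theorem re_inner_act_onSites (hM : ∀ i, (M i).IsHermitian) (hsq : ∀ i, i ≠ j → M i * M i = 1)
    (hφ : ‖φ‖ = 1) :
    (inner ℂ φ (act (onSites s M) φ)).re =
      ((if j ∈ s then (inner ℂ φ (act (atSite j (M j * M j)) φ)).re else 1) + 1) / 2 -
        ‖act (pivot j s M) φ - act (onSites (s.erase j) M) φ‖ ^ 2 / 2 := by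
  have hP : ‖act (pivot j s M) φ‖ ^ 2 =
      if j ∈ s then (inner ℂ φ (act (atSite j (M j * M j)) φ)).re else 1 := by
    rw [← inner_self_eq_norm_sq (𝕜 := ℂ), inner_act, ← act_mul, conjTranspose_pivot hM, pivot]
    split_ifs
    · rw [← atSite_mul]
      exact inner_re_symm _ _
    · rw [one_mul, act_one, inner_self_eq_norm_sq, hφ, one_pow]
  have hQ : ‖act (onSites (s.erase j) M) φ‖ ^ 2 = 1 := by
    rw [← inner_self_eq_norm_sq (𝕜 := ℂ), inner_act, ← act_mul,
      conjTranspose_onSites_of_isHermitian hM, onSites_erase_mul_self hsq, act_one,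
      inner_self_eq_norm_sq, hφ, one_pow]
  have hPQ : inner ℂ (act (pivot j s M) φ) (act (onSites (s.erase j) M) φ) =
      inner ℂ φ (act (onSites s M) φ) := by
    conv_lhs => rw [← conjTranspose_pivot hM]
    rw [← inner_act, ← act_mul, pivot_mul_onSites_erase]
  rw [norm_sub_sq (𝕜 := ℂ), hP, hQ, hPQ]
  simp only [RCLike.re_to_complex]
  ring

theorem act_onSites_eq_self_of_pivot (hsq : ∀ i, i ≠ j → M i * M i = 1)
    (h : act (pivot j s M) φ = act (onSites (s.erase j) M) φ) : act (onSites s M) φ = φ := by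
  rw [← pivot_mul_onSites_erase (j := j), commute_pivot_onSites_erase.eq, act_mul, h, ← act_mul,
    onSites_erase_mul_self hsq, act_one]

theorem act_atSite_sq_of_pivot (hsq : ∀ i, i ≠ j → M i * M i = 1)
    (h : act (pivot j s M) φ = act (onSites (s.erase j) M) φ) (hj : j ∈ s) :
    act (atSite j (M j * M j)) φ = φ := by
  have h' := act_onSites_eq_self_of_pivot hsq h
  rw [← pivot_mul_onSites_erase (j := j), act_mul, ← h, ← act_mul, pivot, if_pos hj,
    ← atSite_mul] at h'
  exact h'

/-- On a stabilized state, a factor of the stabilizer acts like the product of the others. -/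
theorem act_atSite_eq_act_erase {i : ι} (hi : i ∈ s) (h : act (onSites s M) φ = φ)
    (hsq : act (atSite i (M i * M i)) φ = φ) :
    act (atSite i (M i)) φ = act (onSites (s.erase i) M) φ := by
  conv_lhs => rw [← h, onSites_eq_atSite_mul hi]
  rw [← act_mul, ← mul_assoc, ← atSite_mul,
    (commute_atSite_onSites (Finset.notMem_erase i s) _ _).eq, act_mul, hsq]

/-- Two stabilizers that overlap in the sites `i` and `k` commute on the state, so that
anticommutation at `k` forces anticommutation at `i`. -/
theorem anticommute_transfer {t : Finset ι} {N : ∀ i, Matrix (m i) (m i) ℂ} {i k : ι}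
    (hik : i ≠ k) (hks : k ∈ s) (hkt : k ∈ t)
    (hst : ∀ e, e ∈ s → e ∈ t → e = i ∨ e = k)
    (hs : act (atSite i (M i)) φ = act (onSites (s.erase i) M) φ)
    (ht : act (atSite i (N i)) φ = act (onSites (t.erase i) N) φ)
    (hk : act (atSite k (M k * N k + N k * M k)) φ = 0) :
    act (atSite i (M i * N i + N i * M i)) φ = 0 := by
  set Y := onSites ((s.erase i).erase k) M with hY
  set Y' := onSites ((t.erase i).erase k) N with hY'
  have hs' : onSites (s.erase i) M = atSite k (M k) * Y :=
    onSites_eq_atSite_mul (Finset.mem_erase.2 ⟨hik.symm, hks⟩) M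
  have ht' : onSites (t.erase i) N = atSite k (N k) * Y' :=
    onSites_eq_atSite_mul (Finset.mem_erase.2 ⟨hik.symm, hkt⟩) N
  have hYY : Y * Y' = Y' * Y := by
    refine (commute_onSites ?_ M N).eq
    rw [Finset.disjoint_left]
    intro e he he'
    simp only [Finset.mem_erase] at he he'
    rcases hst e he.2.2 he'.2.2 with h | h
    · exact he.2.1 h
    · exact he.1 h
  have cY : ∀ A, atSite k A * Y = Y * atSite k A := fun A =>
    (commute_atSite_onSites (Finset.notMem_erase k _) A M).eq
  have cY' : ∀ A, atSite k A * Y' = Y' * atSite k A := fun A =>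
    (commute_atSite_onSites (Finset.notMem_erase k _) A N).eq
  have key : onSites (t.erase i) N * onSites (s.erase i) M +
      onSites (s.erase i) M * onSites (t.erase i) N =
        Y' * Y * atSite k (M k * N k + N k * M k) := by
    rw [hs', ht', atSite_add, atSite_mul, atSite_mul, cY, cY', mul_add, ← hYY]
    calc _ = Y' * (atSite k (N k) * Y) * atSite k (M k) +
          Y * (atSite k (M k) * Y') * atSite k (N k) := by simp only [mul_assoc]
      _ = Y' * Y * (atSite k (N k) * atSite k (M k)) +
          Y * Y' * (atSite k (M k) * atSite k (N k)) := by rw [cY, cY']; simp only [mul_assoc]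
      _ = _ := by rw [← hYY, add_comm]
  have c1 := (commute_atSite_onSites (Finset.notMem_erase i t) (M i) N).eq
  have c2 := (commute_atSite_onSites (Finset.notMem_erase i s) (N i) M).eq
  rw [atSite_add, atSite_mul, atSite_mul, act_add, act_mul, act_mul, ht, hs, ← act_mul, ← act_mul,
    c1, c2, act_mul, act_mul, hs, ht, ← act_mul, ← act_mul, ← act_add, key, act_mul, hk,
    act_zero_right]

end Stabilized

/-! ### The quantum bound and its saturation -/

namespace Realization

variable {L : ℕ} [NeZero L] {D : Qubit L → ℕ} {E : Type*} [NormedAddCommGroup E]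
  [InnerProductSpace ℂ E] (R : Realization L D E) (j : Qubit L)

theorem isHermitian_tildeX (i : Qubit L) : (R.tildeX j i).IsHermitian := by
  unfold tildeX
  split_ifs
  · rw [Matrix.IsHermitian, Matrix.conjTranspose_smul, Matrix.conjTranspose_add,
      (R.isHermitian_obs i 0).eq, (R.isHermitian_obs i 1).eq]
    simp
  · exact R.isHermitian_obs i 0

theorem isHermitian_tildeZ (i : Qubit L) : (R.tildeZ j i).IsHermitian := by
  unfold tildeZ
  split_ifs
  · rw [Matrix.IsHermitian, Matrix.conjTranspose_smul, Matrix.conjTranspose_sub,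
      (R.isHermitian_obs i 0).eq, (R.isHermitian_obs i 1).eq]
    simp
  · exact R.isHermitian_obs i 1

variable {j} in
theorem tildeX_mul_self {i : Qubit L} (h : i ≠ j) : R.tildeX j i * R.tildeX j i = 1 := by
  rw [tildeX, if_neg h, R.obs_mul_obs]

variable {j} in
theorem tildeZ_mul_self {i : Qubit L} (h : i ≠ j) : R.tildeZ j i * R.tildeZ j i = 1 := by
  rw [tildeZ, if_neg h, R.obs_mul_obs]

theorem inv_sqrt_two_mul_self : ((√2 : ℝ) : ℂ)⁻¹ * ((√2 : ℝ) : ℂ)⁻¹ = 2⁻¹ := by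
  rw [← mul_inv, ← Complex.ofReal_mul, Real.mul_self_sqrt zero_le_two, Complex.ofReal_ofNat]

theorem tildeX_sq_add_tildeZ_sq :
    R.tildeX j j * R.tildeX j j + R.tildeZ j j * R.tildeZ j j = (2 : ℂ) • 1 := by
  rw [tildeX, tildeZ, if_pos rfl, if_pos rfl]
  simp only [smul_mul_smul_comm, inv_sqrt_two_mul_self, add_mul, mul_add, sub_mul, mul_sub,
    R.obs_mul_obs]
  module

theorem tildeX_tildeZ_anticommute :
    R.tildeX j j * R.tildeZ j j + R.tildeZ j j * R.tildeX j j = 0 := by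
  rw [tildeX, tildeZ, if_pos rfl, if_pos rfl]
  simp only [smul_mul_smul_comm, inv_sqrt_two_mul_self, add_mul, mul_add, sub_mul, mul_sub,
    R.obs_mul_obs]
  module

/-- The total deviation from the relations `P φ = Q φ`, where `P * Q` runs over the terms
`∏_{i ∈ s v} M i` of one half of the Bell operator and `P` is its factor at `j`. -/
def defect (s : Site L → Finset (Qubit L)) (M : ∀ i, Matrix (Fin (D i)) (Fin (D i)) ℂ) : ℝ :=
  ∑ v, ‖act (pivot j (s v) M) R.state - act (onSites ((s v).erase j) M) R.state‖ ^ 2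

theorem defect_nonneg (s : Site L → Finset (Qubit L))
    (M : ∀ i, Matrix (Fin (D i)) (Fin (D i)) ℂ) : 0 ≤ R.defect j s M :=
  Finset.sum_nonneg fun _ _ => sq_nonneg _

theorem act_pivot_of_defect_eq_zero {s : Site L → Finset (Qubit L)}
    {M : ∀ i, Matrix (Fin (D i)) (Fin (D i)) ℂ} (h : R.defect j s M = 0) (v : Site L) :
    act (pivot j (s v) M) R.state = act (onSites ((s v).erase j) M) R.state := by
  have := (Finset.sum_eq_zero_iff_of_nonneg fun _ _ => sq_nonneg _).1 h v (Finset.mem_univ v)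
  rwa [sq_eq_zero_iff, norm_eq_zero, sub_eq_zero] at this

theorem sum_re_inner_act {s : Site L → Finset (Qubit L)}
    (hs : (Finset.univ.filter fun v => j ∈ s v).card = 2)
    {M : ∀ i, Matrix (Fin (D i)) (Fin (D i)) ℂ} (hM : ∀ i, (M i).IsHermitian)
    (hsq : ∀ i, i ≠ j → M i * M i = 1) :
    ∑ v, (inner ℂ R.state (act (onSites (s v) M) R.state)).re =
      Fintype.card (Site L) +
        ((inner ℂ R.state (act (atSite j (M j * M j)) R.state)).re - 1) -
          R.defect j s M / 2 := by
  set q := (inner ℂ R.state (act (atSite j (M j * M j)) R.state)).re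
  rw [Finset.sum_congr rfl fun v _ => re_inner_act_onSites hM hsq R.norm_state,
    Finset.sum_sub_distrib, ← Finset.sum_div, ← Finset.sum_div]
  congr 1
  have : ∀ v, (if j ∈ s v then q else 1) + 1 = (if j ∈ s v then q - 1 else 0) + 2 := by
    intro v; split_ifs <;> ring
  rw [Finset.sum_congr rfl fun v _ => this v, Finset.sum_add_distrib, ← Finset.sum_filter,
    Finset.sum_const, Finset.sum_const, hs, Finset.card_univ, nsmul_eq_mul, nsmul_eq_mul]
  push_cast
  ring

theorem reducedState_eq (i : Qubit L) : R.reducedState i = reduced R.state i := rfl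

theorem act_atSite_eq_self {i : Qubit L} {M : Matrix (Fin (D i)) (Fin (D i)) ℂ}
    (h : M * R.reducedState i = R.reducedState i) : act (atSite i M) R.state = R.state := by
  rw [reducedState_eq] at h
  exact ToricCode.act_atSite_eq_self h

variable [Fact (1 < L)]

/-- The Bell value is the number of qubits minus a sum of squares: the terms at `j` are bounded
since `X̃⁽ʲ⁾² + Z̃⁽ʲ⁾² = 2` and `j` lies on two stars and two boundaries. -/
theorem bellValue_eq : R.bellValue j = Fintype.card (Qubit L) -
    (R.defect j starOf (R.tildeX j) + R.defect j boundaryOf (R.tildeZ j)) / 2 := by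
  have h2 : (inner ℂ R.state (act (atSite j (R.tildeX j j * R.tildeX j j)) R.state)).re +
      (inner ℂ R.state (act (atSite j (R.tildeZ j j * R.tildeZ j j)) R.state)).re = 2 := by
    rw [← Complex.add_re, ← inner_add_right, ← act_add, ← atSite_add, tildeX_sq_add_tildeZ_sq,
      atSite_smul, atSite_one, act_smul, act_one, inner_smul_right, inner_self_eq_norm_sq_to_K,
      R.norm_state]
    simp
  have hN : (Fintype.card (Qubit L) : ℝ) =
      Fintype.card (Site L) + Fintype.card (Site L) := by
    rw [Fintype.card_prod, Fintype.card_bool, mul_two, Nat.cast_add]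
  rw [bellValue, bellOp, act_add, act_sum, act_sum, inner_add_right, inner_sum, inner_sum,
    Complex.add_re, Complex.re_sum, Complex.re_sum,
    R.sum_re_inner_act j (card_filter_mem_starOf j) (R.isHermitian_tildeX j)
      fun _ => R.tildeX_mul_self,
    R.sum_re_inner_act j (card_filter_mem_boundaryOf j) (R.isHermitian_tildeZ j)
      fun _ => R.tildeZ_mul_self, hN]
  linear_combination h2

theorem bellValue_le : R.bellValue j ≤ Fintype.card (Qubit L) := by
  rw [bellValue_eq]
  linarith [R.defect_nonneg j starOf (R.tildeX j), R.defect_nonneg j boundaryOf (R.tildeZ j)]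

variable {j} (hR : R.bellValue j = Fintype.card (Qubit L))

include hR

theorem defect_tildeX_eq_zero : R.defect j starOf (R.tildeX j) = 0 := by
  rw [bellValue_eq] at hR
  linarith [R.defect_nonneg j starOf (R.tildeX j), R.defect_nonneg j boundaryOf (R.tildeZ j)]

theorem defect_tildeZ_eq_zero : R.defect j boundaryOf (R.tildeZ j) = 0 := by
  rw [bellValue_eq] at hR
  linarith [R.defect_nonneg j starOf (R.tildeX j), R.defect_nonneg j boundaryOf (R.tildeZ j)]

theorem act_star (v : Site L) : act (onSites (starOf v) (R.tildeX j)) R.state = R.state :=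
  act_onSites_eq_self_of_pivot (fun _ => R.tildeX_mul_self)
    (R.act_pivot_of_defect_eq_zero j (R.defect_tildeX_eq_zero hR) v)

theorem act_boundary (p : Site L) : act (onSites (boundaryOf p) (R.tildeZ j)) R.state = R.state :=
  act_onSites_eq_self_of_pivot (fun _ => R.tildeZ_mul_self)
    (R.act_pivot_of_defect_eq_zero j (R.defect_tildeZ_eq_zero hR) p)

theorem act_tildeX_sq (i : Qubit L) :
    act (atSite i (R.tildeX j i * R.tildeX j i)) R.state = R.state := by
  by_cases h : i = j
  · subst h
    exact act_atSite_sq_of_pivot (fun _ => R.tildeX_mul_self)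
      (R.act_pivot_of_defect_eq_zero i (R.defect_tildeX_eq_zero hR) i.1)
      (mem_starOf.2 (Or.inl rfl))
  · rw [R.tildeX_mul_self h, atSite_one, act_one]

theorem act_tildeZ_sq (i : Qubit L) :
    act (atSite i (R.tildeZ j i * R.tildeZ j i)) R.state = R.state := by
  by_cases h : i = j
  · subst h
    exact act_atSite_sq_of_pivot (fun _ => R.tildeZ_mul_self)
      (R.act_pivot_of_defect_eq_zero i (R.defect_tildeZ_eq_zero hR) i.1)
      (mem_boundaryOf.2 (Or.inl rfl))
  · rw [R.tildeZ_mul_self h, atSite_one, act_one]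

theorem act_tildeX {i : Qubit L} {v : Site L} (hi : i ∈ starOf v) :
    act (atSite i (R.tildeX j i)) R.state =
      act (onSites ((starOf v).erase i) (R.tildeX j)) R.state :=
  act_atSite_eq_act_erase hi (R.act_star hR v) (R.act_tildeX_sq hR i)

theorem act_tildeZ {i : Qubit L} {p : Site L} (hi : i ∈ boundaryOf p) :
    act (atSite i (R.tildeZ j i)) R.state =
      act (onSites ((boundaryOf p).erase i) (R.tildeZ j)) R.state :=
  act_atSite_eq_act_erase hi (R.act_boundary hR p) (R.act_tildeZ_sq hR i)

/-- Anticommutation on the state at `j`, which holds by construction, spreads from edge to edge: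
a vertex and a plaquette at that vertex share exactly two edges. -/
theorem act_anticommutator (i : Qubit L) :
    act (atSite i (R.tildeX j i * R.tildeZ j i + R.tildeZ j i * R.tildeX j i)) R.state = 0 := by
  set P : Qubit L → Prop := fun i =>
    act (atSite i (R.tildeX j i * R.tildeZ j i + R.tildeZ j i * R.tildeX j i)) R.state = 0
  have step : ∀ (i k : Qubit L) (v p : Site L), i ≠ k → i ∈ starOf v → i ∈ boundaryOf p →
      k ∈ starOf v → k ∈ boundaryOf p →
      (∀ e, e ∈ starOf v → e ∈ boundaryOf p → e = i ∨ e = k) → (P i ↔ P k) :=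
    fun i k v p hne hi hi' hk hk' h =>
      ⟨anticommute_transfer hne.symm hi hi' (fun e he he' => (h e he he').symm)
          (R.act_tildeX hR hk) (R.act_tildeZ hR hk'),
        anticommute_transfer hne hk hk' h (R.act_tildeX hR hi) (R.act_tildeZ hR hi')⟩
  have h₁ : ∀ x y, P ((x, y), false) ↔ P ((x, y), true) := fun x y =>
    step _ _ (x, y) (x, y) (by simp) (by simp [starOf]) (by simp [boundaryOf])
      (by simp [starOf]) (by simp [boundaryOf]) (starOf_inter_boundaryOf_self x y)
  have h₂ : ∀ x y, P ((x, y), false) ↔ P ((x + 1, y), true) := fun x y =>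
    step _ _ (x + 1, y) (x, y) (by simp) (by simp [starOf]) (by simp [boundaryOf])
      (by simp [starOf]) (by simp [boundaryOf]) (starOf_inter_boundaryOf_right x y)
  have h₃ : ∀ x y, P ((x, y + 1), false) ↔ P ((x, y), true) := fun x y =>
    step _ _ (x, y + 1) (x, y) (by simp) (by simp [starOf]) (by simp [boundaryOf])
      (by simp [starOf]) (by simp [boundaryOf]) (starOf_inter_boundaryOf_top x y)
  have hj : P j := by
    simp only [P]
    rw [R.tildeX_tildeZ_anticommute j, ← sub_self (1 : Matrix _ _ ℂ), atSite_sub, act_sub,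
      sub_self]
  have hj' : P (j.1, false) := by
    obtain ⟨⟨x, y⟩, _ | _⟩ := j
    · exact hj
    · exact (h₁ x y).2 hj
  have hall : ∀ a : Site L, P (a, false) :=
    site_induction (P := fun a => P (a, false)) (fun x y h => (h₁ _ _).2 ((h₂ _ _).1 h))
      (fun x y h => (h₃ _ _).2 ((h₁ _ _).1 h)) hj'
  obtain ⟨⟨x, y⟩, _ | _⟩ := i
  · exact hall _
  · exact (h₁ x y).1 (hall _)

theorem tildeX_sq_mul_reducedState (i : Qubit L) :
    R.tildeX j i * R.tildeX j i * R.reducedState i = R.reducedState i := by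
  rw [reducedState_eq]
  exact reduced_mul_eq_self (m := fun i => Fin (D i)) (R.act_tildeX_sq hR i)

theorem tildeZ_sq_mul_reducedState (i : Qubit L) :
    R.tildeZ j i * R.tildeZ j i * R.reducedState i = R.reducedState i := by
  rw [reducedState_eq]
  exact reduced_mul_eq_self (m := fun i => Fin (D i)) (R.act_tildeZ_sq hR i)

theorem anticommutator_mul_reducedState (i : Qubit L) :
    (R.tildeX j i * R.tildeZ j i + R.tildeZ j i * R.tildeX j i) * R.reducedState i = 0 := by
  rw [reducedState_eq]
  exact reduced_mul_eq_zero (m := fun i => Fin (D i)) (R.act_anticommutator hR i)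

theorem tildeX_mul_reducedState (i : Qubit L) :
    R.tildeX j i * R.reducedState i = R.reducedState i * R.tildeX j i := by
  rw [reducedState_eq]
  exact commute_reduced (m := fun i => Fin (D i)) (R.isHermitian_tildeX j i)
    (Finset.notMem_erase i _) (R.isHermitian_tildeX j)
    (R.act_tildeX hR (v := i.1) (mem_starOf.2 (Or.inl rfl)))

theorem tildeZ_mul_reducedState (i : Qubit L) :
    R.tildeZ j i * R.reducedState i = R.reducedState i * R.tildeZ j i := by
  rw [reducedState_eq]
  exact commute_reduced (m := fun i => Fin (D i)) (R.isHermitian_tildeZ j i)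
    (Finset.notMem_erase i _) (R.isHermitian_tildeZ j)
    (R.act_tildeZ hR (p := i.1) (mem_boundaryOf.2 (Or.inl rfl)))

end Realization

/-! ### The ideal realization -/

section Ideal

variable {L : ℕ} [NeZero L]

theorem isHermitian_pauliX : pauliX.IsHermitian := by
  ext i k; fin_cases i <;> fin_cases k <;> simp [pauliX]

theorem isHermitian_pauliZ : pauliZ.IsHermitian := by
  ext i k; fin_cases i <;> fin_cases k <;> simp [pauliZ]

/-- A code vector shared by the parties, who measure Pauli operators, and party `j` their
normalized sum and difference. The space `E` is one-dimensional. -/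
def idealRealization (j : Qubit L) (ψ : EuclideanSpace ℂ (Qubit L → Fin 2)) (hψ : ‖ψ‖ = 1) :
    Realization L (fun _ => 2) (EuclideanSpace ℂ PUnit.{u + 1}) where
  state := WithLp.toLp 2 fun x => ψ x • EuclideanSpace.single PUnit.unit 1
  norm_state := by
    rw [PiLp.norm_eq_of_L2, ← hψ, EuclideanSpace.norm_eq]
    simp [norm_smul]
  obs i x :=
    if i = j then ((√2 : ℝ) : ℂ)⁻¹ • (if x = 0 then pauliX + pauliZ else pauliX - pauliZ)
    else if x = 0 then pauliX else pauliZ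
  isHermitian_obs i x := by
    split_ifs
    · rw [Matrix.IsHermitian, Matrix.conjTranspose_smul,
        (isHermitian_pauliX.add isHermitian_pauliZ).eq]
      simp
    · rw [Matrix.IsHermitian, Matrix.conjTranspose_smul,
        (isHermitian_pauliX.sub isHermitian_pauliZ).eq]
      simp
    · exact isHermitian_pauliX
    · exact isHermitian_pauliZ
  obs_mul_obs i x := by
    split_ifs
    · rw [smul_mul_smul_comm, Realization.inv_sqrt_two_mul_self]
      simp only [add_mul, mul_add, pauliX_mul_self, pauliZ_mul_self, pauliZ_mul_pauliX]
      module
    · rw [smul_mul_smul_comm, Realization.inv_sqrt_two_mul_self]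
      simp only [sub_mul, mul_sub, pauliX_mul_self, pauliZ_mul_self, pauliZ_mul_pauliX]
      module
    · exact pauliX_mul_self
    · exact pauliZ_mul_self

variable (j : Qubit L) {ψ : EuclideanSpace ℂ (Qubit L → Fin 2)} (hψ : ‖ψ‖ = 1)

theorem tildeX_idealRealization :
    (idealRealization.{u} j ψ hψ).tildeX j = fun _ => pauliX := by
  ext1 i
  by_cases h : i = j
  · simp only [Realization.tildeX, idealRealization, h, if_true, one_ne_zero, if_false,
      ← smul_add, smul_smul, Realization.inv_sqrt_two_mul_self]
    module
  · simp [Realization.tildeX, idealRealization, h]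

theorem tildeZ_idealRealization :
    (idealRealization.{u} j ψ hψ).tildeZ j = fun _ => pauliZ := by
  ext1 i
  by_cases h : i = j
  · simp only [Realization.tildeZ, idealRealization, h, if_true, one_ne_zero, if_false,
      ← smul_sub, smul_smul, Realization.inv_sqrt_two_mul_self]
    module
  · simp [Realization.tildeZ, idealRealization, h]

theorem act_idealRealization {M : Matrix (Qubit L → Fin 2) (Qubit L → Fin 2) ℂ}
    (h : act M ψ = ψ) :
    act M (idealRealization.{u} j ψ hψ).state = (idealRealization.{u} j ψ hψ).state := by
  ext1 x
  change ∑ y, M x y • ψ y • EuclideanSpace.single PUnit.unit (1 : ℂ) = ψ x • _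
  conv_rhs => rw [← h, act_apply]
  simp only [Finset.sum_smul, smul_smul, smul_eq_mul]

theorem bellValue_idealRealization (hc : ψ ∈ codeSpace L) :
    (idealRealization.{u} j ψ hψ).bellValue j = Fintype.card (Qubit L) := by
  rw [mem_codeSpace] at hc
  have hX : ∀ v, act (onSites (starOf v) ((idealRealization.{u} j ψ hψ).tildeX j))
      (idealRealization.{u} j ψ hψ).state = (idealRealization.{u} j ψ hψ).state := fun v => by
    rw [tildeX_idealRealization]
    exact act_idealRealization j hψ (hc.1 v)
  have hZ : ∀ p, act (onSites (boundaryOf p) ((idealRealization.{u} j ψ hψ).tildeZ j))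
      (idealRealization.{u} j ψ hψ).state = (idealRealization.{u} j ψ hψ).state := fun p => by
    rw [tildeZ_idealRealization]
    exact act_idealRealization j hψ (hc.2 p)
  rw [Realization.bellValue, Realization.bellOp, act_add, act_sum, act_sum,
    Finset.sum_congr rfl fun v _ => hX v, Finset.sum_congr rfl fun p _ => hZ p, Finset.sum_const,
    ← add_nsmul, ← Nat.cast_smul_eq_nsmul ℂ, inner_smul_right, inner_self_eq_norm_sq_to_K,
    (idealRealization.{u} j ψ hψ).norm_state, Finset.card_univ, Fintype.card_prod (Site L),
    Fintype.card_bool, mul_two]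
  simp

end Ideal

/-! ### Decomposition along the code space -/

section Decomposition

variable {ι : Type*} {d : ι → ℕ} {E : Type*} [NormedAddCommGroup E] [InnerProductSpace ℂ E]

/-- The basis of `⨂ i, ℂ² ⊗ ℂ ^ (d i)` as a product of the bases of `⨂ i, ℂ²` and
`⨂ i, ℂ ^ (d i)`. -/
def splitEquiv (d : ι → ℕ) : (ι → Fin 2) × (∀ i, Fin (d i)) ≃ (∀ i, Fin 2 × Fin (d i)) where
  toFun q i := (q.1 i, q.2 i)
  invFun w := (fun i => (w i).1, fun i => (w i).2)
  left_inv _ := rfl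
  right_inv _ := rfl

theorem smul_joint (c : ℂ) (ψ : EuclideanSpace ℂ (ι → Fin 2))
    (ξ : PiLp 2 (fun _ : (∀ i, Fin (d i)) => E)) : c • joint ψ ξ = joint ψ (c • ξ) := by
  ext w
  simp [joint, smul_comm c]

variable [Fintype ι] [DecidableEq ι]

theorem inner_joint (ψ ψ' : EuclideanSpace ℂ (ι → Fin 2))
    (ξ ξ' : PiLp 2 (fun _ : (∀ i, Fin (d i)) => E)) :
    inner ℂ (joint ψ ξ) (joint ψ' ξ') = inner ℂ ψ ψ' * inner ℂ ξ ξ' := by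
  rw [PiLp.inner_apply, ← (splitEquiv d).sum_comp, Fintype.sum_prod_type, PiLp.inner_apply,
    PiLp.inner_apply, Finset.sum_mul_sum]
  refine Finset.sum_congr rfl fun x _ => Finset.sum_congr rfl fun y _ => ?_
  change inner ℂ (ψ x • ξ y) (ψ' x • ξ' y) = _
  rw [inner_smul_left, inner_smul_right]
  simp only [RCLike.inner_apply]
  ring

/-- The `E`-valued vector of the qubits at the basis vector `y` of `⨂ i, ℂ ^ (d i)`. -/
def slice (φ : PiLp 2 (fun _ : (∀ i, Fin 2 × Fin (d i)) => E)) (y : ∀ i, Fin (d i)) :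
    PiLp 2 (fun _ : ι → Fin 2 => E) :=
  WithLp.toLp 2 fun x => φ (splitEquiv d (x, y))

theorem act_slice (s : Finset ι) (P : Matrix (Fin 2) (Fin 2) ℂ)
    (φ : PiLp 2 (fun _ : (∀ i, Fin 2 × Fin (d i)) => E)) (y : ∀ i, Fin (d i)) :
    act (onSites s fun _ => P) (slice φ y) =
      slice (act (onSites s fun i => P ⊗ₖ (1 : Matrix (Fin (d i)) (Fin (d i)) ℂ)) φ) y := by
  ext x
  change ∑ x', _ = ∑ w, _
  rw [← (splitEquiv d).sum_comp, Fintype.sum_prod_type]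
  refine Finset.sum_congr rfl fun x' _ => ?_
  have hent : ∀ y', onSites s (fun i => P ⊗ₖ (1 : Matrix (Fin (d i)) (Fin (d i)) ℂ))
      (splitEquiv d (x, y)) (splitEquiv d (x', y')) =
        onSites s (fun _ => P) x x' * if y = y' then 1 else 0 := by
    intro y'
    simp only [onSites, tensorMat, Matrix.of_apply]
    have : (if y = y' then (1 : ℂ) else 0) = ∏ i, if y i = y' i then 1 else 0 := by
      rw [Finset.prod_ite_zero]
      simp [funext_iff]
    rw [this, ← Finset.prod_mul_distrib]
    refine Finset.prod_congr rfl fun i _ => ?_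
    split_ifs <;> simp_all [splitEquiv, Matrix.one_apply]
  rw [Finset.sum_eq_single y]
  · rw [hent, if_pos rfl, mul_one]
    rfl
  · intro y' _ hy
    rw [hent, if_neg hy.symm, mul_zero, zero_smul]
  · simp

end Decomposition

section CodeExpansion

variable {L : ℕ} [NeZero L] {E : Type*} [NormedAddCommGroup E] [InnerProductSpace ℂ E]

/-- An `E`-valued vector that is fixed by all stabilizers expands in any orthonormal basis of the
code space. As `E` need not be complete, the expansion is tested against each vector of `E`. -/
theorem eq_sum_of_stabilized {κ : Type*} [Fintype κ]
    {ψ : κ → EuclideanSpace ℂ (Qubit L → Fin 2)} (hψ : Orthonormal ℂ ψ)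
    (hspan : Submodule.span ℂ (Set.range ψ) = codeSpace L)
    {f : PiLp 2 (fun _ : Qubit L → Fin 2 => E)} (hv : ∀ v, act (vertexOp v) f = f)
    (hp : ∀ p, act (plaquetteOp p) f = f) (x : Qubit L → Fin 2) :
    f x = ∑ k, ψ k x • ∑ x', star (ψ k x') • f x' := by
  refine ext_inner_left ℂ fun e => ?_
  let g : EuclideanSpace ℂ (Qubit L → Fin 2) := WithLp.toLp 2 fun x => inner ℂ e (f x)
  have hact : ∀ M : Matrix (Qubit L → Fin 2) (Qubit L → Fin 2) ℂ, act M f = f → act M g = g := by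
    intro M hM
    ext x
    change ∑ y, M x y • inner ℂ e (f y) = inner ℂ e (f x)
    conv_rhs => rw [← hM, act_apply, inner_sum]
    simp only [inner_smul_right, smul_eq_mul]
  have hg : g ∈ codeSpace L :=
    mem_codeSpace.2 ⟨fun v => hact _ (hv v), fun p => hact _ (hp p)⟩
  rw [← hspan, Submodule.mem_span_range_iff_exists_fun] at hg
  obtain ⟨c, hc⟩ := hg
  have hck : ∀ k, c k = ∑ x', star (ψ k x') * inner ℂ e (f x') := by
    intro k
    rw [← hψ.inner_right_fintype c k, hc, PiLp.inner_apply]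
    simp [g, mul_comm]
  change g x = _
  rw [← hc]
  simp [inner_sum, inner_smul_right, hck, mul_comm]

/-- A unit vector of `(⨂ i, ℂ² ⊗ ℂ ^ (d i)) ⊗ E` that is fixed by all stabilizers is a normalized
superposition of the code states, each with its own junk state. -/
theorem exists_code_decomposition {d : Qubit L → ℕ} {κ : Type*} [Fintype κ]
    {φ : PiLp 2 (fun _ : (∀ i, Fin 2 × Fin (d i)) => E)} (hφ : ‖φ‖ = 1)
    (hv : ∀ v, act (onSites (starOf v) fun i => pauliX ⊗ₖ (1 : Matrix (Fin (d i)) (Fin (d i)) ℂ))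
      φ = φ)
    (hp : ∀ p, act (onSites (boundaryOf p)
      fun i => pauliZ ⊗ₖ (1 : Matrix (Fin (d i)) (Fin (d i)) ℂ)) φ = φ)
    {ψ : κ → EuclideanSpace ℂ (Qubit L → Fin 2)} (hψ : Orthonormal ℂ ψ)
    (hspan : Submodule.span ℂ (Set.range ψ) = codeSpace L) :
    ∃ (c : κ → ℝ) (ξ : κ → PiLp 2 (fun _ : (∀ i, Fin (d i)) => E)),
      (∀ k, 0 ≤ c k) ∧ ∑ k, c k ^ 2 = 1 ∧ (∀ k, ‖ξ k‖ = 1) ∧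
      φ = ∑ k, (c k : ℂ) • joint (ψ k) (ξ k) := by
  classical
  let η : κ → PiLp 2 (fun _ : (∀ i, Fin (d i)) => E) := fun k =>
    WithLp.toLp 2 fun y => ∑ x', star (ψ k x') • slice φ y x'
  have hsum : φ = ∑ k, joint (ψ k) (η k) := by
    ext w
    have := eq_sum_of_stabilized hψ hspan (f := slice φ fun i => (w i).2)
      (fun v => by rw [vertexOp, act_slice, hv]) (fun p => by rw [plaquetteOp, act_slice, hp])
      (fun i => (w i).1)
    rw [WithLp.ofLp_sum, Finset.sum_apply]
    exact this
  have hnorm : ∑ k, ‖η k‖ ^ 2 = 1 := by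
    have h1 : inner ℂ φ φ = ∑ k, ((‖η k‖ ^ 2 : ℝ) : ℂ) := by
      conv_lhs => rw [hsum]
      rw [sum_inner]
      refine Finset.sum_congr rfl fun k _ => ?_
      rw [inner_sum, Finset.sum_eq_single k]
      · rw [inner_joint, inner_self_eq_norm_sq_to_K, hψ.1 k, inner_self_eq_norm_sq_to_K]
        simp
      · intro l _ hl
        rw [inner_joint, hψ.2 hl.symm, zero_mul]
      · simp
    rw [inner_self_eq_norm_sq_to_K, hφ, ← Complex.ofReal_sum, RCLike.ofReal_one, one_pow] at h1
    exact_mod_cast h1.symm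
  obtain ⟨k₀, hk₀⟩ : ∃ k, η k ≠ 0 := by
    by_contra! h
    simp [h] at hnorm
  -- where the coefficient vanishes, any unit vector may serve as the junk state
  refine ⟨fun k => ‖η k‖, fun k => if η k = 0 then ((‖η k₀‖ : ℂ)⁻¹) • η k₀
    else ((‖η k‖ : ℂ)⁻¹) • η k, fun k => norm_nonneg _, hnorm, fun k => ?_, ?_⟩
  · dsimp only
    split_ifs with h
    · exact norm_smul_inv_norm hk₀
    · exact norm_smul_inv_norm h
  · conv_lhs => rw [hsum]
    refine Finset.sum_congr rfl fun k _ => ?_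
    rw [smul_joint]
    congr 1
    dsimp only
    split_ifs with h
    · simp [h]
    · rw [smul_smul, mul_inv_cancel₀ (by simpa using h), one_smul]

end CodeExpansion

/-! ### Local isometries -/

section Isometries

variable {ι : Type*} [Fintype ι] [DecidableEq ι] {m n : ι → Type*} [∀ i, Fintype (m i)]
  [∀ i, Fintype (n i)] [∀ i, DecidableEq (n i)]
  {E : Type*} [NormedAddCommGroup E] [InnerProductSpace ℂ E]

theorem tensorMat_mul_onSites [∀ i, DecidableEq (m i)] {U : ∀ i, Matrix (m i) (n i) ℂ}
    {M : ∀ i, Matrix (n i) (n i) ℂ} {N : ∀ i, Matrix (m i) (m i) ℂ}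
    (h : ∀ i, U i * M i = N i * U i) (s : Finset ι) :
    tensorMat U * onSites s M = onSites s N * tensorMat U := by
  rw [onSites, onSites, tensorMat_mul, tensorMat_mul]
  congr 1; ext1 i
  split_ifs
  · exact h i
  · rw [Matrix.mul_one, Matrix.one_mul]

theorem norm_act_tensorMat {U : ∀ i, Matrix (m i) (n i) ℂ}
    {φ : PiLp 2 (fun _ : (∀ i, n i) => E)}
    (h : ∀ i, act (atSite i ((U i)ᴴ * U i)) φ = φ) : ‖act (tensorMat U) φ‖ = ‖φ‖ := by
  have h1 : act (tensorMat fun i => (U i)ᴴ * U i) φ = φ := by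
    have := act_onSites_eq_self Finset.univ fun i _ => h i
    simpa [onSites] using this
  have h2 : inner ℂ (act (tensorMat U) φ) (act (tensorMat U) φ) = inner ℂ φ φ := by
    rw [inner_act, ← act_mul, conjTranspose_tensorMat, tensorMat_mul, h1]
  rw [@norm_eq_sqrt_re_inner ℂ, h2, ← @norm_eq_sqrt_re_inner ℂ]

/-- A coisometry fixes the range of its adjoint. -/
theorem conjTranspose_mul_self_mul {m n : Type*} [Fintype m] [DecidableEq m] [Fintype n]
    [DecidableEq n] {U : Matrix m n ℂ} {ρ : Matrix n n ℂ} (hU : U * Uᴴ = 1)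
    (h : LinearMap.range Uᴴ.mulVecLin = LinearMap.range ρ.mulVecLin) : Uᴴ * U * ρ = ρ := by
  refine Matrix.ext_of_mulVec_single fun i => ?_
  obtain ⟨w, hw⟩ : ρ.mulVecLin (Pi.single i 1) ∈ LinearMap.range Uᴴ.mulVecLin :=
    h ▸ LinearMap.mem_range_self _ _
  rw [Matrix.mulVecLin_apply, Matrix.mulVecLin_apply] at hw
  rw [← Matrix.mulVec_mulVec, ← hw, Matrix.mulVec_mulVec, Matrix.mul_assoc, hU, Matrix.mul_one]

end Isometries

theorem isGreatest_quantumValues {L : ℕ} [NeZero L] [Fact (1 < L)] (j : Qubit L) :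
    IsGreatest (quantumValues.{u} L j) (Fintype.card (Qubit L) : ℝ) := by
  constructor
  · have : Nontrivial (codeSpace L) :=
      Module.nontrivial_of_finrank_pos (R := ℂ) (by rw [finrank_codeSpace]; norm_num)
    obtain ⟨ψ, hψ⟩ := exists_norm_eq (codeSpace L) zero_le_one
    have hψ' : ‖(ψ : EuclideanSpace ℂ (Qubit L → Fin 2))‖ = 1 := hψ
    exact ⟨fun _ => 2, EuclideanSpace ℂ PUnit.{u + 1}, inferInstance, inferInstance,
      idealRealization j ψ hψ', bellValue_idealRealization j hψ' ψ.2⟩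
  · rintro _ ⟨D, E, _, _, R, rfl⟩
    exact R.bellValue_le j

end ToricCode

end

theorem fact2 (L : ℕ) [NeZero L] (hL : 2 ≤ L) (j : Qubit L) :
    -- the maximal quantum value is the number of qubits, and the code space has dimension four
    IsGreatest (quantumValues.{u} L j) (Fintype.card (Qubit L) : ℝ) ∧
    Module.finrank ℂ (codeSpace L) = 4 ∧
    -- every realization that reaches it is, up to local unitaries, the ideal one
    ∀ (D : Qubit L → ℕ) (E : Type u) [NormedAddCommGroup E] [InnerProductSpace ℂ E]
      (R : Realization L D E), R.bellValue j = (Fintype.card (Qubit L) : ℝ) →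
      (∀ i,
        R.tildeX j i * R.tildeX j i * R.reducedState i = R.reducedState i ∧
        R.tildeZ j i * R.tildeZ j i * R.reducedState i = R.reducedState i ∧
        (R.tildeX j i * R.tildeZ j i + R.tildeZ j i * R.tildeX j i) * R.reducedState i = 0) ∧
      ∃ (d : Qubit L → ℕ) (U : ∀ i, Matrix (Fin 2 × Fin (d i)) (Fin (D i)) ℂ),
        -- `U i` maps the support of the reduced state unitarily onto `ℂ² ⊗ ℂ ^ (d i)`
        -- and vanishes on the orthogonal complement of that support
        (∀ i,
          U i * (U i)ᴴ = 1 ∧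
          LinearMap.range ((U i)ᴴ).mulVecLin = LinearMap.range (R.reducedState i).mulVecLin ∧
          U i * R.tildeX j i = (pauliX ⊗ₖ (1 : Matrix (Fin (d i)) (Fin (d i)) ℂ)) * U i ∧
          U i * R.tildeZ j i = (pauliZ ⊗ₖ (1 : Matrix (Fin (d i)) (Fin (d i)) ℂ)) * U i) ∧
        ∀ ψ : Fin 4 → EuclideanSpace ℂ (Qubit L → Fin 2),
          Orthonormal ℂ ψ → Submodule.span ℂ (Set.range ψ) = codeSpace L →
          ∃ (c : Fin 4 → ℝ) (ξ : Fin 4 → PiLp 2 (fun _ : (∀ i, Fin (d i)) => E)),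
            (∀ k, 0 ≤ c k) ∧ ∑ k, c k ^ 2 = 1 ∧ (∀ k, ‖ξ k‖ = 1) ∧
            act (tensorMat U) R.state = ∑ k, (c k : ℂ) • joint (ψ k) (ξ k) := by
  have : Fact (1 < L) := ⟨hL⟩
  refine ⟨isGreatest_quantumValues j, finrank_codeSpace, ?_⟩
  intro D E _ _ R hR
  have hXX := R.tildeX_sq_mul_reducedState hR
  have hZZ := R.tildeZ_sq_mul_reducedState hR
  have hXZ := R.anticommutator_mul_reducedState hR
  refine ⟨fun i => ⟨hXX i, hZZ i, hXZ i⟩, ?_⟩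
  choose d U hUU hrange hUX hUZ using fun i =>
    exists_pauli_frame (R.isHermitian_tildeX j i) (R.isHermitian_tildeZ j i)
      (R.tildeX_mul_reducedState hR i) (R.tildeZ_mul_reducedState hR i) (hXX i) (hZZ i) (hXZ i)
  refine ⟨d, U, fun i => ⟨hUU i, hrange i, hUX i, hUZ i⟩, fun ψ hψ hspan => ?_⟩
  refine exists_code_decomposition ?_ (fun v => ?_) (fun p => ?_) hψ hspan
  · rw [norm_act_tensorMat fun i => R.act_atSite_eq_self
      (conjTranspose_mul_self_mul (hUU i) (hrange i)), R.norm_state]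
  · rw [← act_mul, ← tensorMat_mul_onSites hUX, act_mul, R.act_star hR]
  · rw [← act_mul, ← tensorMat_mul_onSites hUZ, act_mul, R.act_boundary hR]
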